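/- Let $E\neq 0$ be an endomorphism of $\mathbb R^7=\langle e_1,\dots,e_7\rangle$, and let $(\mathbb R^8,E)$ be the quasi-abelian Lie algebra $\mathbb R^8=\langle e_0,\dots,e_7\rangle$ in which $\mathbb R^7$ is an abelian ideal and $\mathrm{ad}(e_0)|_{\mathbb R^7}=E$, endowed with the standard metric and orientation. Write $E_{13}=\frac12(E+E^{T})$ and $E_{24}=\frac12(E-E^{T})$ for the symmetric and skew-symmetric parts of $E$. An invariant $\mathrm{Spin}(7)$ structure on $(\mathbb R^8,E)$ is a $4$-form $\Omega$ on $\mathbb R^8$ which, in the coframe dual to some positively oriented orthonormal basis, is $$e^{0123}-e^{0145}-e^{0167}-e^{0246}+e^{0257}-e^{0347}-e^{0356}+e^{4567}-e^{2367}-e^{2345}-e^{1357}+e^{1346}-e^{1256}-e^{1247}.$$ Let $d$ be the exterior derivative of left-invariant forms (the Chevalley–Eilenberg differential) and let $\Lambda^3=\Lambda^3_8\oplus\Lambda^3_{48}$ be the orthogonal $\mathrm{Spin}(7)$-decomposition of the $3$-forms determined by $\Omega$, where $\Lambda^3_8=\{i(v)\Omega : v\in\mathbb R^8\}$. The structure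 $\Omega$ is parallel if $*d\Omega=0$; locally conformally parallel if $*d\Omega\in\Lambda^3_8$; balanced if $*d\Omega\in\Lambda^3_{48}$; and of mixed type if both components of $*d\Omega$ are nonzero. A skew-symmetric endomorphism $S$ of $\mathbb R^7$ is associated to $(\lambda_1,\lambda_2,\lambda_3)$, where $0\le\lambda_1\le\lambda_2\le\lambda_3$, if there is a positively oriented orthonormal basis $(v_1,w_1,v_2,w_2,v_3,w_3,u)$ of $\mathbb R^7$ with $S v_j=\lambda_j w_j$, $S w_j=-\lambda_j v_j$ and $S u=0$. Then $(\mathbb R^8,E)$ admits an invariant $\mathrm{Spin}(7)$ structure (compatible with the standard metric and orientation) of type 1. parallel, if and only if $E_{13}=0$ and $E_{24}$ is associated to $(\lambda_1,\lambda_2,\lambda_1+\lambda_2)$ for some $0\le\lambda_1\le\lambda_2$ with $\lambda_2>0$; 2. locally conformally parallel and non-parallel, if and only if $E_{13}=h\,\mathrm{Id}$ for some $h\ne0$ and $E_{24}$ is associated to $(\lambda_1,\lambda_2,\lambda_1+\lambda_2)$ for some $0\le\lambda_1\le\lambda_2$; 3. balanced, if and only if the Lie algebra is unimodular (its volume form is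 not exact) and $E_{24}$ is associated to $(\lambda_1,\lambda_2,\lambda_1+\lambda_2)$ for some $0\le\lambda_1\le\lambda_2$. Here the Lie algebra $(\mathbb R^8,E)$ is unimodular if and only if $E$ is traceless. Moreover, if $E_{24}\neq0$, then $(\mathbb R^8,E)$ admits an invariant $\mathrm{Spin}(7)$ structure of mixed type. -/

import Mathlib

/-! ### The quasi-abelian Lie algebra `(ℝ⁸, E)` -/

/-- The vector space `ℝ⁸ = ⟨e₀, …, e₇⟩` with its standard Euclidean metric, tagged by a `7 × 7`
matrix `E` that determines its Lie bracket. -/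
def QuasiAbelian (_E : Matrix (Fin 7) (Fin 7) ℝ) : Type := EuclideanSpace ℝ (Fin 8)

namespace QuasiAbelian

variable (E : Matrix (Fin 7) (Fin 7) ℝ)

noncomputable instance : NormedAddCommGroup (QuasiAbelian E) :=
  inferInstanceAs (NormedAddCommGroup (EuclideanSpace ℝ (Fin 8)))

noncomputable instance : InnerProductSpace ℝ (QuasiAbelian E) :=
  inferInstanceAs (InnerProductSpace ℝ (EuclideanSpace ℝ (Fin 8)))

/-- The standard orthonormal basis `e₀, …, e₇`; it is declared to be positively oriented. -/
noncomputable def stdBasis : OrthonormalBasis (Fin 8) ℝ (QuasiAbelian E) :=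
  EuclideanSpace.basisFun (Fin 8) ℝ

variable {E}

/-- The coordinate `x₀` of `x` along `e₀`. -/
def fst (x : QuasiAbelian E) : ℝ := WithLp.ofLp x 0

/-- The component of `x` in `ℝ⁷ = ⟨e₁, …, e₇⟩`. -/
def snd (x : QuasiAbelian E) : Fin 7 → ℝ := fun i => WithLp.ofLp x i.succ

/-- The vector `t e₀ + v` with `v ∈ ℝ⁷`. -/
def mk (t : ℝ) (v : Fin 7 → ℝ) : QuasiAbelian E := WithLp.toLp 2 (Fin.cons t v)

theorem ext_iff' {x y : QuasiAbelian E} : x = y ↔ x.fst = y.fst ∧ x.snd = y.snd := by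
  constructor
  · rintro rfl
    exact ⟨rfl, rfl⟩
  · rintro ⟨h0, h1⟩
    refine (WithLp.ofLp_injective 2) (funext fun i => ?_)
    exact Fin.cases h0 (fun j => congrFun h1 j) i

theorem fst_mk (t : ℝ) (v : Fin 7 → ℝ) : (mk t v : QuasiAbelian E).fst = t := rfl
theorem snd_mk (t : ℝ) (v : Fin 7 → ℝ) : (mk t v : QuasiAbelian E).snd = v := rfl
theorem fst_add (x y : QuasiAbelian E) : (x + y).fst = x.fst + y.fst := rfl
theorem snd_add (x y : QuasiAbelian E) : (x + y).snd = x.snd + y.snd := rfl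
theorem fst_zero : (0 : QuasiAbelian E).fst = 0 := rfl
theorem snd_zero : (0 : QuasiAbelian E).snd = 0 := rfl
theorem fst_smul (c : ℝ) (x : QuasiAbelian E) : (c • x).fst = c * x.fst := rfl
theorem snd_smul (c : ℝ) (x : QuasiAbelian E) : (c • x).snd = c • x.snd := rfl

/-- `[x₀ e₀ + v, y₀ e₀ + w] = x₀ E w - y₀ E v` for `v, w ∈ ℝ⁷`: the subspace `ℝ⁷` is an abelian
ideal and `ad(e₀)` restricts to `E` on it. -/
noncomputable instance : Bracket (QuasiAbelian E) (QuasiAbelian E) where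
  bracket x y := mk 0 (x.fst • E.mulVec y.snd - y.fst • E.mulVec x.snd)

theorem fst_bracket (x y : QuasiAbelian E) : ⁅x, y⁆.fst = 0 := rfl

theorem snd_bracket (x y : QuasiAbelian E) :
    ⁅x, y⁆.snd = x.fst • E.mulVec y.snd - y.fst • E.mulVec x.snd := rfl

noncomputable instance : LieRing (QuasiAbelian E) where
  add_lie x y z := by
    rw [ext_iff']
    simp only [fst_bracket, snd_bracket, fst_add, snd_add, Matrix.mulVec_add]
    exact ⟨by simp, by module⟩
  lie_add x y z := by
    rw [ext_iff']
    simp only [fst_bracket, snd_bracket, fst_add, snd_add, Matrix.mulVec_add]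
    exact ⟨by simp, by module⟩
  lie_self x := by
    rw [ext_iff']
    simp only [fst_bracket, snd_bracket, fst_zero, snd_zero]
    exact ⟨trivial, by module⟩
  leibniz_lie x y z := by
    rw [ext_iff']
    simp only [fst_bracket, snd_bracket, fst_add, snd_add, Matrix.mulVec_sub, Matrix.mulVec_smul]
    exact ⟨by simp, by module⟩

noncomputable instance : LieAlgebra ℝ (QuasiAbelian E) where
  lie_smul c x y := by
    rw [ext_iff']
    simp only [fst_bracket, snd_bracket, fst_smul, snd_smul, Matrix.mulVec_smul]
    exact ⟨by simp, by module⟩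

end QuasiAbelian

/-! ### Exterior algebra on a Lie algebra with a metric

A left-invariant `k`-form on a Lie group is an alternating `k`-linear form on its Lie algebra. -/

namespace InvForm

section Lie

variable {g : Type*} [LieRing g] [LieAlgebra ℝ g]

/-- The bilinear map `(x, y) ↦ α([x, y], …)`. -/
noncomputable def bracketCurry {k : ℕ} (α : g [⋀^Fin (k + 1)]→ₗ[ℝ] ℝ) :
    g →ₗ[ℝ] g →ₗ[ℝ] g [⋀^Fin k]→ₗ[ℝ] ℝ :=
  LinearMap.mk₂ ℝ (fun x y => α.curryLeft ⁅x, y⁆)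
    (fun x y z => by rw [add_lie, map_add]) (fun c x y => by rw [smul_lie, map_smul])
    (fun x y z => by rw [lie_add, map_add]) (fun c x y => by rw [lie_smul, map_smul])

/-- The exterior derivative of a left-invariant form (the Chevalley-Eilenberg differential),
`dα(x₀, …, x_{k+1}) = ∑_{i < j} (-1)^{i+j} α([x_i, x_j], x₀, …, x̂_i, …, x̂_j, …, x_{k+1})`.
The double alternation below counts each pair `i < j` twice, and with the opposite sign; see
`d_apply` for the usual formula. -/
noncomputable def d {k : ℕ} (α : g [⋀^Fin (k + 1)]→ₗ[ℝ] ℝ) : g [⋀^Fin (k + 2)]→ₗ[ℝ] ℝ :=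
  (-(1 / 2) : ℝ) • AlternatingMap.alternatizeUncurryFin
    (AlternatingMap.alternatizeUncurryFinLM ∘ₗ bracketCurry α)

/-- The usual formula for `d`; the pair `i ≤ j` below stands for the pair `i < j + 1` of positions
in `x`. -/
theorem d_apply {k : ℕ} (α : g [⋀^Fin (k + 1)]→ₗ[ℝ] ℝ) (x : Fin (k + 2) → g) :
    d α x = ∑ i : Fin (k + 1), ∑ j ≥ i, (-1 : ℝ) ^ ((i : ℕ) + (j + 1 : ℕ)) *
      α (Matrix.vecCons ⁅x i.castSucc, x j.succ⁆ (j.removeNth (i.castSucc.removeNth x))) := by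
  rw [d, AlternatingMap.smul_apply,
    AlternatingMap.alternatizeUncurryFin_alternatizeUncurryFinLM_comp_apply, Finset.smul_sum]
  refine Finset.sum_congr rfl fun i _ => ?_
  rw [Finset.smul_sum]
  refine Finset.sum_congr rfl fun j _ => ?_
  have h : bracketCurry α (x j.succ) (x i.castSucc)
      = - bracketCurry α (x i.castSucc) (x j.succ) := by
    simp only [bracketCurry, LinearMap.mk₂_apply]
    rw [← lie_skew, map_neg]
  rw [h, AlternatingMap.neg_apply]
  simp only [bracketCurry, LinearMap.mk₂_apply, AlternatingMap.curryLeft_apply_apply, zsmul_eq_mul,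
    smul_eq_mul]
  push_cast
  ring

end Lie

section Metric

variable {V : Type*} [NormedAddCommGroup V] [InnerProductSpace ℝ V]

/-- The form `x ↦ ω(u₀, …, u_{k-1}, x₀, …, x_{l-1})`. -/
def contract {l : ℕ} : {k : ℕ} → (Fin k → V) → V [⋀^Fin (l + k)]→ₗ[ℝ] ℝ → V [⋀^Fin l]→ₗ[ℝ] ℝ
  | 0, _, ω => ω
  | _ + 1, u, ω => contract (Fin.tail u) (ω.curryLeft (u 0))

/-- The Hodge star `Λᵏ → Λˡ` on an oriented Euclidean space of dimension `l + k` with positively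
oriented orthonormal basis `b`:
`(⋆β)(x) = ∑_{i₁ < ⋯ < i_k} β(b_{i₁}, …, b_{i_k}) vol(b_{i₁}, …, b_{i_k}, x₁, …, x_l)`, so that
`α ∧ ⋆β = ⟨α, β⟩ vol`. -/
noncomputable def hodgeStar (l k : ℕ) (b : OrthonormalBasis (Fin (l + k)) ℝ V)
    (β : V [⋀^Fin k]→ₗ[ℝ] ℝ) : V [⋀^Fin l]→ₗ[ℝ] ℝ :=
  ∑ I : Fin k ↪o Fin (l + k), β (fun a => b (I a)) • contract (fun a => b (I a)) b.toBasis.det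

/-- The inner product of two `k`-forms, computed in an orthonormal basis `b`. -/
noncomputable def formInner {n k : ℕ} (b : OrthonormalBasis (Fin n) ℝ V)
    (α β : V [⋀^Fin k]→ₗ[ℝ] ℝ) : ℝ :=
  ∑ I : Fin k ↪o Fin n, α (fun a => b (I a)) * β (fun a => b (I a))

/-- `e^{i₁ ⋯ i_k} = e^{i₁} ∧ ⋯ ∧ e^{i_k}`, where `eⁱ` is the coframe dual to the basis `b`; on
`(x₁, …, x_k)` it is the determinant of the matrix `e^{i_a}(x_c)`. -/
noncomputable def coframe {n k : ℕ} (b : OrthonormalBasis (Fin n) ℝ V) (i : Fin k → Fin n) :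
    V [⋀^Fin k]→ₗ[ℝ] ℝ :=
  Matrix.detRowAlternating.compLinearMap (LinearMap.pi fun a => b.toBasis.coord (i a))

/-- The standard `Spin(7)` form (Cayley form) in the orthonormal frame `b`. -/
noncomputable def cayleyForm (b : OrthonormalBasis (Fin 8) ℝ V) : V [⋀^Fin 4]→ₗ[ℝ] ℝ :=
  coframe b ![0, 1, 2, 3] - coframe b ![0, 1, 4, 5] - coframe b ![0, 1, 6, 7]
    - coframe b ![0, 2, 4, 6] + coframe b ![0, 2, 5, 7] - coframe b ![0, 3, 4, 7]
    - coframe b ![0, 3, 5, 6] + coframe b ![4, 5, 6, 7] - coframe b ![2, 3, 6, 7]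
    - coframe b ![2, 3, 4, 5] - coframe b ![1, 3, 5, 7] + coframe b ![1, 3, 4, 6]
    - coframe b ![1, 2, 5, 6] - coframe b ![1, 2, 4, 7]

/-- `Ω` is the 4-form of a `Spin(7)` structure on the oriented Euclidean space `V` (with positively
oriented orthonormal basis `e`): it has the standard form in some positively oriented orthonormal
frame (a Cayley frame). -/
def IsSpin7Form (e : OrthonormalBasis (Fin 8) ℝ V) (Ω : V [⋀^Fin 4]→ₗ[ℝ] ℝ) : Prop :=
  ∃ b : OrthonormalBasis (Fin 8) ℝ V,
    b.toBasis.orientation = e.toBasis.orientation ∧ Ω = cayleyForm b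

/-- The component `Λ³₈ = {i(v)Ω}` of the 3-forms, determined by a `Spin(7)` form `Ω`. -/
def Lambda8 (Ω : V [⋀^Fin 4]→ₗ[ℝ] ℝ) : Set (V [⋀^Fin 3]→ₗ[ℝ] ℝ) :=
  {β | ∃ v : V, β = Ω.curryLeft v}

/-- The complementary component `Λ³₄₈` in the orthogonal `Spin(7)` decomposition
`Λ³ = Λ³₈ ⊕ Λ³₄₈`. -/
def Lambda48 (e : OrthonormalBasis (Fin 8) ℝ V) (Ω : V [⋀^Fin 4]→ₗ[ℝ] ℝ) :
    Set (V [⋀^Fin 3]→ₗ[ℝ] ℝ) :=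
  {β | ∀ γ ∈ Lambda8 Ω, formInner e β γ = 0}

end Metric

end InvForm

/-! ### Invariant `Spin(7)` structures on `(ℝ⁸, E)` -/

namespace QuasiAbelian

variable {E : Matrix (Fin 7) (Fin 7) ℝ}

/-- `Ω` is an invariant `Spin(7)` structure compatible with the standard metric and orientation. -/
def IsSpin7 (Ω : QuasiAbelian E [⋀^Fin 4]→ₗ[ℝ] ℝ) : Prop :=
  InvForm.IsSpin7Form (stdBasis E) Ω

/-- The 3-form `⋆dΩ`. -/
noncomputable def starD (Ω : QuasiAbelian E [⋀^Fin 4]→ₗ[ℝ] ℝ) :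
    QuasiAbelian E [⋀^Fin 3]→ₗ[ℝ] ℝ :=
  InvForm.hodgeStar 3 5 (stdBasis E) (InvForm.d Ω)

def IsParallel (Ω : QuasiAbelian E [⋀^Fin 4]→ₗ[ℝ] ℝ) : Prop :=
  starD Ω = 0

def IsLocConfParallel (Ω : QuasiAbelian E [⋀^Fin 4]→ₗ[ℝ] ℝ) : Prop :=
  starD Ω ∈ InvForm.Lambda8 Ω

def IsBalanced (Ω : QuasiAbelian E [⋀^Fin 4]→ₗ[ℝ] ℝ) : Prop :=
  starD Ω ∈ InvForm.Lambda48 (stdBasis E) Ω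

/-- Mixed type: `⋆dΩ` lies in neither component, that is, both of its components are nonzero. -/
def IsMixed (Ω : QuasiAbelian E [⋀^Fin 4]→ₗ[ℝ] ℝ) : Prop :=
  ¬ IsLocConfParallel Ω ∧ ¬ IsBalanced Ω

variable (E)

/-- Unimodularity: the volume form is not exact. -/
def IsUnimodular : Prop :=
  ¬ ∃ α : QuasiAbelian E [⋀^Fin 7]→ₗ[ℝ] ℝ, InvForm.d α = (stdBasis E).toBasis.det

/-- The symmetric part `E₁₃`. -/
noncomputable def symPart : Matrix (Fin 7) (Fin 7) ℝ := (1 / 2 : ℝ) • (E + E.transpose)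

/-- The skew-symmetric part `E₂₄`. -/
noncomputable def skewPart : Matrix (Fin 7) (Fin 7) ℝ := (1 / 2 : ℝ) • (E - E.transpose)

end QuasiAbelian

/-- The skew endomorphism with `e₁ ↦ a e₂`, `e₃ ↦ b e₄`, `e₅ ↦ c e₆`, `e₇ ↦ 0`. -/
def skewNormalForm (a b c : ℝ) : Matrix (Fin 7) (Fin 7) ℝ :=
  !![0, -a, 0, 0, 0, 0, 0;
     a, 0, 0, 0, 0, 0, 0;
     0, 0, 0, -b, 0, 0, 0;
     0, 0, b, 0, 0, 0, 0;
     0, 0, 0, 0, 0, -c, 0;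
     0, 0, 0, 0, c, 0, 0;
     0, 0, 0, 0, 0, 0, 0]

/-- The skew-symmetric endomorphism `S` of `ℝ⁷` is associated to `(a, b, c)`, `0 ≤ a ≤ b ≤ c`: in
some positively oriented orthonormal basis (the columns of `P`) it has the above normal form. -/
def IsAssociated (S : Matrix (Fin 7) (Fin 7) ℝ) (a b c : ℝ) : Prop :=
  (0 ≤ a ∧ a ≤ b ∧ b ≤ c) ∧ ∃ P ∈ Matrix.specialOrthogonalGroup (Fin 7) ℝ,
    S = P * skewNormalForm a b c * P.transpose

/-! `Spin(7)` acts transitively on unit vectors, so every compatible Cayley form has a Cayley frame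
whose first vector is `e₀` (`exists_cayleyFrame`). The invariant structures are therefore
parametrized by rotations `R` of `ℝ⁷`, and `ad(e₀)` has the matrix `M = Rᵀ E R` in the corresponding
frame (`exists_isSpin7_iff`).

In such a frame `⋆dΩ` is linear in `M`. Under `G₂`, endomorphisms of `ℝ⁷` split into scalars,
traceless symmetric matrices, `Λ²₇` and `Λ²₁₄`, the last being the Lie algebra of `G₂`. This Lie
algebra is exactly the kernel of `M ↦ ⋆dΩ`. The component of `⋆dΩ` in `Λ³₈` sees the trace and the
`Λ²₇` part `g2Part M` (`formInner_starD`). Thus each pure type requires `g2Part M = 0`, together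
with a symmetric part that is zero (parallel), scalar (locally conformally parallel) or traceless
(balanced); see `starD_eq_curryLeft_iff` and `isBalanced_cayleyForm_iff`. The conditions on the
symmetric part do not depend on `R`.

It remains to decide when some rotation carries the skew part `S` into the Lie algebra of `G₂`
(`exists_g2Part_eq_zero_iff`). Let `S` have weights `a ≤ b ≤ c`. If `c = a + b`, a permutation of
the normal form basis works. Conversely, `4 tr X⁴ = (tr X²)²` on that Lie algebra, and both traces
are invariant under conjugation. For the normal form this says that the Heron product
`(a+b+c)(a+b-c)(a-b+c)(b+c-a)` vanishes, and the ordering gives `c = a + b`.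

For mixed type, two permutations of the basis give `g2Part` proportional to `a + b - c` and to `b +
c - a`. Both vanish only if `S = 0`. -/

open scoped InnerProductSpace

namespace InvForm

/-! ### The Cayley form as a polynomial in coordinates -/

/-- The `4 × 4` determinant, expanded along its first two columns. -/
def det4 (p q r s : Fin 4 → ℝ) : ℝ :=
  (p 0 * q 1 - p 1 * q 0) * (r 2 * s 3 - r 3 * s 2)
    - (p 0 * q 2 - p 2 * q 0) * (r 1 * s 3 - r 3 * s 1)
    + (p 0 * q 3 - p 3 * q 0) * (r 1 * s 2 - r 2 * s 1)
    + (p 1 * q 2 - p 2 * q 1) * (r 0 * s 3 - r 3 * s 0)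
    - (p 1 * q 3 - p 3 * q 1) * (r 0 * s 2 - r 2 * s 0)
    + (p 2 * q 3 - p 3 * q 2) * (r 0 * s 1 - r 1 * s 0)

/-- The value of the Cayley form on four vectors, as a polynomial in the rows of coordinates. -/
def cayleyPoly (X : Fin 8 → Fin 4 → ℝ) : ℝ :=
  det4 (X 0) (X 1) (X 2) (X 3) - det4 (X 0) (X 1) (X 4) (X 5) - det4 (X 0) (X 1) (X 6) (X 7)
    - det4 (X 0) (X 2) (X 4) (X 6) + det4 (X 0) (X 2) (X 5) (X 7) - det4 (X 0) (X 3) (X 4) (X 7)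
    - det4 (X 0) (X 3) (X 5) (X 6) + det4 (X 4) (X 5) (X 6) (X 7) - det4 (X 2) (X 3) (X 6) (X 7)
    - det4 (X 2) (X 3) (X 4) (X 5) - det4 (X 1) (X 3) (X 5) (X 7) + det4 (X 1) (X 3) (X 4) (X 6)
    - det4 (X 1) (X 2) (X 5) (X 6) - det4 (X 1) (X 2) (X 4) (X 7)

variable {V : Type*} [NormedAddCommGroup V] [InnerProductSpace ℝ V]

theorem coframe_four_apply {n : ℕ} (b : OrthonormalBasis (Fin n) ℝ V) (p q r s : Fin n)
    (x : Fin 4 → V) :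
    coframe b ![p, q, r, s] x = det4 (fun a => ⟪b p, x a⟫_ℝ) (fun a => ⟪b q, x a⟫_ℝ)
      (fun a => ⟪b r, x a⟫_ℝ) (fun a => ⟪b s, x a⟫_ℝ) := by
  have h : coframe b ![p, q, r, s] x =
      Matrix.det (Matrix.of fun c a => ⟪b (![p, q, r, s] a), x c⟫_ℝ) := by
    rw [coframe, AlternatingMap.compLinearMap_apply]
    change Matrix.det _ = _
    congr 1
    ext c a
    simp [OrthonormalBasis.repr_apply_apply]
  rw [h, Matrix.det_succ_row_zero]
  simp [Fin.sum_univ_succ, Matrix.det_fin_three, Fin.succAbove, det4]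
  ring

/-- Equalities between Cayley forms of different frames become polynomial identities in the frame
coordinates. -/
theorem cayleyForm_apply (b : OrthonormalBasis (Fin 8) ℝ V) (x : Fin 4 → V) :
    cayleyForm b x = cayleyPoly fun i a => ⟪b i, x a⟫_ℝ := by
  simp only [cayleyForm, AlternatingMap.add_apply, AlternatingMap.sub_apply, coframe_four_apply,
    cayleyPoly]

/-! ### Plane rotations of an orthonormal basis -/

/-- The basis vectors rotated in the plane of `b i` and `b j`. -/
def rotVec {n : ℕ} (b : Fin n → V) (i j : Fin n) (c s : ℝ) : Fin n → V :=
  Function.update (Function.update b i (c • b i + s • b j)) j (-s • b i + c • b j)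

theorem orthonormal_rotVec {n : ℕ} {b : Fin n → V} (hb : Orthonormal ℝ b) {i j : Fin n}
    (hij : i ≠ j) {c s : ℝ} (h : c ^ 2 + s ^ 2 = 1) : Orthonormal ℝ (rotVec b i j c s) := by
  rw [orthonormal_iff_ite] at hb ⊢
  intro k l
  have e : ∀ k, rotVec b i j c s k = if k = j then -s • b i + c • b j else
      if k = i then c • b i + s • b j else b k := by
    intro k
    simp only [rotVec, Function.update_apply]
  rw [e, e]
  split_ifs <;>
    simp only [inner_add_left, inner_add_right, real_inner_smul_left, real_inner_smul_right, hb] <;>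
    split_ifs <;> grind

/-- An orthonormal basis rotated in the plane of its `i`-th and `j`-th vectors. -/
noncomputable def rot {n : ℕ} (b : OrthonormalBasis (Fin n) ℝ V) (i j : Fin n) (hij : i ≠ j)
    (c s : ℝ) (h : c ^ 2 + s ^ 2 = 1) : OrthonormalBasis (Fin n) ℝ V :=
  haveI : FiniteDimensional ℝ V := b.toBasis.finiteDimensional_of_finite
  OrthonormalBasis.mk (orthonormal_rotVec b.orthonormal hij h) (by
    rw [(orthonormal_rotVec b.orthonormal hij h).linearIndependent.span_eq_top_of_card_eq_finrank'
      (by rw [Module.finrank_eq_card_basis b.toBasis])])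

theorem rot_apply {n : ℕ} (b : OrthonormalBasis (Fin n) ℝ V) (i j : Fin n) (hij : i ≠ j)
    (c s : ℝ) (h : c ^ 2 + s ^ 2 = 1) (k : Fin n) :
    rot b i j hij c s h k = if k = j then -s • b i + c • b j else
      if k = i then c • b i + s • b j else b k := by
  simp only [rot, OrthonormalBasis.coe_mk, rotVec, Function.update_apply]

theorem rot_orientation {n : ℕ} (b : OrthonormalBasis (Fin n) ℝ V) (i j : Fin n) (hij : i ≠ j)
    (c s : ℝ) (h : c ^ 2 + s ^ 2 = 1) :
    (rot b i j hij c s h).toBasis.orientation = b.toBasis.orientation := by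
  rw [eq_comm, Module.Basis.orientation_eq_iff_det_pos]
  have e : ⇑(rot b i j hij c s h).toBasis = rotVec b i j c s := by
    simp [rot]
  have key : b.toBasis.det (rotVec b i j c s) = 1 := by
    have h1 : Function.update (Function.update (⇑b) i (b j)) j (b i) = b ∘ Equiv.swap i j := by
      ext k
      simp only [Function.update_apply, Function.comp, Equiv.swap_apply_def]
      split_ifs <;> simp_all
    have h2 : b.toBasis.det b = 1 := by
      rw [← OrthonormalBasis.coe_toBasis, Module.Basis.det_self]
    have hu : ∀ x y : V, Function.update (Function.update (⇑b) i x) j y =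
        Function.update (Function.update (⇑b) j y) i x := fun x y =>
      Function.update_comm hij _ _ _
    have h3 : Function.update (Function.update (⇑b) i (b i)) j (b j) = b := by simp
    have h4 : b.toBasis.det (Function.update (Function.update (⇑b) i (b i)) j (b i)) = 0 :=
      AlternatingMap.map_eq_zero_of_eq _ _ (i := i) (j := j) (by simp [hij]) hij
    have h5 : b.toBasis.det (Function.update (Function.update (⇑b) i (b j)) j (b j)) = 0 :=
      AlternatingMap.map_eq_zero_of_eq _ _ (i := i) (j := j) (by simp [hij]) hij
    have h6 : b.toBasis.det (Function.update (Function.update (⇑b) i (b j)) j (b i)) = -1 := by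
      rw [h1, AlternatingMap.map_swap _ _ hij, h2]
    have h7 := congrArg b.toBasis.det h3
    rw [h2] at h7
    -- Expansion in the two rotated slots leaves four terms. Those with a repeated vector vanish,
    -- the unswapped one gives `c²`, and the swapped one gives `-s² · (-1)`.
    rw [rotVec, AlternatingMap.map_update_add, AlternatingMap.map_update_smul,
      AlternatingMap.map_update_smul, hu, hu, AlternatingMap.map_update_add,
      AlternatingMap.map_update_smul, AlternatingMap.map_update_smul,
      AlternatingMap.map_update_add, AlternatingMap.map_update_smul,
      AlternatingMap.map_update_smul, ← hu, ← hu, ← hu, ← hu, h4, h5, h6, h7]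
    simp only [smul_eq_mul]
    linear_combination h
  rw [e, key]
  exact one_pos

end InvForm

namespace InvForm

/-! ### Transitivity of `Spin(7)` on unit vectors -/

/-- Rows of coordinates after a rotation in the plane `(0, i)` and one in the plane `(p, q)`. -/
def doubleRot (i p q : Fin 8) (c s t : ℝ) (X : Fin 8 → Fin 4 → ℝ) (k : Fin 8) (a : Fin 4) : ℝ :=
  if k = q then -t * X p a + c * X q a else
  if k = p then c * X p a + t * X q a else
  if k = i then -s * X 0 a + c * X i a else
  if k = 0 then c * X 0 a + s * X i a else X k a

/-- A rotation in the plane `(0, i)` composed with the rotation in the plane `(p, q)` by the same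
or the opposite angle preserves the Cayley form. -/
def IsCayleyFlag (i p q : Fin 8) : Prop :=
  (0 ≠ i ∧ p ≠ q ∧ p ≠ 0 ∧ p ≠ i ∧ q ≠ 0 ∧ q ≠ i) ∧ ∃ ε : ℝ, ε ^ 2 = 1 ∧
    ∀ (X : Fin 8 → Fin 4 → ℝ) (c s : ℝ), c ^ 2 + s ^ 2 = 1 →
      cayleyPoly (doubleRot i p q c s (ε * s) X) = cayleyPoly X

/-- In all seven flags `{0, i, p, q}` and its complement both index terms of the Cayley form. Write
`r = c² + s²`. The double rotation scales the first term by `r²`, the second by `1`, and the sum of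
the other twelve by `r`. Hence `key`, whose right-hand side vanishes when `r = 1`. The sign `ε` is
the one for which the twelve terms recombine. -/
theorem cayleyFlag_1_2_3 : IsCayleyFlag 1 2 3 := by
  refine ⟨by decide, -1, by norm_num, fun X c s h => ?_⟩
  have key : cayleyPoly (doubleRot 1 2 3 c s (-1 * s) X) - (c ^ 2 + s ^ 2) * cayleyPoly X =
      (c ^ 2 + s ^ 2 - 1) * ((c ^ 2 + s ^ 2) * (det4 (X 0) (X 1) (X 2) (X 3))
        - (det4 (X 4) (X 5) (X 6) (X 7))) := by
    simp [cayleyPoly, doubleRot, det4]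
    ring
  rw [h] at key
  linarith

theorem cayleyFlag_2_4_6 : IsCayleyFlag 2 4 6 := by
  refine ⟨by decide, 1, by norm_num, fun X c s h => ?_⟩
  have key : cayleyPoly (doubleRot 2 4 6 c s (1 * s) X) - (c ^ 2 + s ^ 2) * cayleyPoly X =
      (c ^ 2 + s ^ 2 - 1) * ((c ^ 2 + s ^ 2) * (-det4 (X 0) (X 2) (X 4) (X 6))
        - (-det4 (X 1) (X 3) (X 5) (X 7))) := by
    simp [cayleyPoly, doubleRot, det4]
    ring
  rw [h] at key
  linarith

theorem cayleyFlag_4_3_7 : IsCayleyFlag 4 3 7 := by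
  refine ⟨by decide, -1, by norm_num, fun X c s h => ?_⟩
  have key : cayleyPoly (doubleRot 4 3 7 c s (-1 * s) X) - (c ^ 2 + s ^ 2) * cayleyPoly X =
      (c ^ 2 + s ^ 2 - 1) * ((c ^ 2 + s ^ 2) * (-det4 (X 0) (X 3) (X 4) (X 7))
        - (-det4 (X 1) (X 2) (X 5) (X 6))) := by
    simp [cayleyPoly, doubleRot, det4]
    ring
  rw [h] at key
  linarith

theorem cayleyFlag_3_1_2 : IsCayleyFlag 3 1 2 := by
  refine ⟨by decide, -1, by norm_num, fun X c s h => ?_⟩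
  have key : cayleyPoly (doubleRot 3 1 2 c s (-1 * s) X) - (c ^ 2 + s ^ 2) * cayleyPoly X =
      (c ^ 2 + s ^ 2 - 1) * ((c ^ 2 + s ^ 2) * (det4 (X 0) (X 1) (X 2) (X 3))
        - (det4 (X 4) (X 5) (X 6) (X 7))) := by
    simp [cayleyPoly, doubleRot, det4]
    ring
  rw [h] at key
  linarith

theorem cayleyFlag_5_1_4 : IsCayleyFlag 5 1 4 := by
  refine ⟨by decide, 1, by norm_num, fun X c s h => ?_⟩
  have key : cayleyPoly (doubleRot 5 1 4 c s (1 * s) X) - (c ^ 2 + s ^ 2) * cayleyPoly X =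
      (c ^ 2 + s ^ 2 - 1) * ((c ^ 2 + s ^ 2) * (-det4 (X 0) (X 1) (X 4) (X 5))
        - (-det4 (X 2) (X 3) (X 6) (X 7))) := by
    simp [cayleyPoly, doubleRot, det4]
    ring
  rw [h] at key
  linarith

theorem cayleyFlag_6_2_4 : IsCayleyFlag 6 2 4 := by
  refine ⟨by decide, 1, by norm_num, fun X c s h => ?_⟩
  have key : cayleyPoly (doubleRot 6 2 4 c s (1 * s) X) - (c ^ 2 + s ^ 2) * cayleyPoly X =
      (c ^ 2 + s ^ 2 - 1) * ((c ^ 2 + s ^ 2) * (-det4 (X 0) (X 2) (X 4) (X 6))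
        - (-det4 (X 1) (X 3) (X 5) (X 7))) := by
    simp [cayleyPoly, doubleRot, det4]
    ring
  rw [h] at key
  linarith

theorem cayleyFlag_7_3_4 : IsCayleyFlag 7 3 4 := by
  refine ⟨by decide, 1, by norm_num, fun X c s h => ?_⟩
  have key : cayleyPoly (doubleRot 7 3 4 c s (1 * s) X) - (c ^ 2 + s ^ 2) * cayleyPoly X =
      (c ^ 2 + s ^ 2 - 1) * ((c ^ 2 + s ^ 2) * (-det4 (X 0) (X 3) (X 4) (X 7))
        - (-det4 (X 1) (X 2) (X 5) (X 6))) := by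
    simp [cayleyPoly, doubleRot, det4]
    ring
  rw [h] at key
  linarith
theorem exists_rotation (x y : ℝ) :
    ∃ c s : ℝ, c ^ 2 + s ^ 2 = 1 ∧ -s * x + c * y = 0 ∧ 0 ≤ c * x + s * y := by
  by_cases h : x ^ 2 + y ^ 2 = 0
  · have hx : x = 0 := by nlinarith [sq_nonneg x, sq_nonneg y]
    have hy : y = 0 := by nlinarith [sq_nonneg x, sq_nonneg y]
    exact ⟨1, 0, by norm_num, by simp [hy], by simp [hx]⟩
  · have hp : 0 < x ^ 2 + y ^ 2 := lt_of_le_of_ne (by positivity) (Ne.symm h)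
    have hr := Real.sqrt_pos.mpr hp
    have hr2 := Real.sq_sqrt hp.le
    set r := Real.sqrt (x ^ 2 + y ^ 2)
    refine ⟨x / r, y / r, ?_, ?_, ?_⟩
    · rw [div_pow, div_pow, hr2]
      field_simp
    · ring
    · have : x / r * x + y / r * y = r := by
        field_simp
        linarith
      rw [this]
      exact hr.le

variable {V : Type*} [NormedAddCommGroup V] [InnerProductSpace ℝ V]

/-- The rotation in the plane `(0, i)` kills the coefficient of `e` along `b i`. The compensating
rotation mixes only `b p` and `b q`, so coefficients killed earlier stay zero provided `p` and `q`
are both in `Z` or both outside it. -/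
theorem IsCayleyFlag.exists_inner_eq_zero {i p q : Fin 8} (h : IsCayleyFlag i p q)
    (b : OrthonormalBasis (Fin 8) ℝ V) (e : V) (Z : Finset (Fin 8)) (h0 : 0 ∉ Z)
    (hZ : p ∈ Z ↔ q ∈ Z) (hb : ∀ k ∈ Z, ⟪b k, e⟫_ℝ = 0) :
    ∃ b' : OrthonormalBasis (Fin 8) ℝ V, b'.toBasis.orientation = b.toBasis.orientation ∧
      cayleyForm b' = cayleyForm b ∧ (∀ k ∈ insert i Z, ⟪b' k, e⟫_ℝ = 0) ∧ 0 ≤ ⟪b' 0, e⟫_ℝ := by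
  obtain ⟨⟨h1, h2, h3, h4, h5, h6⟩, ε, hε, hX⟩ := h
  obtain ⟨c, s, hcs, hs, hc⟩ := exists_rotation ⟪b 0, e⟫_ℝ ⟪b i, e⟫_ℝ
  have hcs' : c ^ 2 + (ε * s) ^ 2 = 1 := by rw [mul_pow, hε, one_mul, hcs]
  have hv : ∀ k, rot (rot b 0 i h1 c s hcs) p q h2 c (ε * s) hcs' k =
      if k = q then -(ε * s) • b p + c • b q else
      if k = p then c • b p + (ε * s) • b q else
      if k = i then -s • b 0 + c • b i else
      if k = 0 then c • b 0 + s • b i else b k := by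
    intro k
    simp only [rot_apply]
    split_ifs <;> simp_all
  refine ⟨rot (rot b 0 i h1 c s hcs) p q h2 c (ε * s) hcs', ?_, ?_, ?_, ?_⟩
  · rw [rot_orientation, rot_orientation]
  · ext x
    rw [cayleyForm_apply, cayleyForm_apply, ← hX (fun i a => ⟪b i, x a⟫_ℝ) c s hcs]
    congr 1
    ext k a
    rw [hv, doubleRot]
    split_ifs <;> simp only [inner_add_left, real_inner_smul_left]
  · intro k hk
    rw [hv]
    rw [Finset.mem_insert] at hk
    split_ifs with g1 g2 g3 g4
    · subst g1
      have hk' := hk.resolve_left h6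
      rw [inner_add_left, real_inner_smul_left, real_inner_smul_left, hb _ hk', hb _ (hZ.mpr hk')]
      ring
    · subst g2
      have hk' := hk.resolve_left h4
      rw [inner_add_left, real_inner_smul_left, real_inner_smul_left, hb _ hk', hb _ (hZ.mp hk')]
      ring
    · rw [inner_add_left, real_inner_smul_left, real_inner_smul_left, hs]
    · exact absurd (hk.resolve_left g3) (g4 ▸ h0)
    · exact hb _ (hk.resolve_left g3)
  · rw [hv, if_neg h5.symm, if_neg h3.symm, if_neg h1, if_pos rfl, inner_add_left,
      real_inner_smul_left, real_inner_smul_left]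
    exact hc

/-- Every Cayley form has a Cayley frame starting with a given unit vector. -/
theorem exists_cayleyFrame (b : OrthonormalBasis (Fin 8) ℝ V) (e : V) (he : ‖e‖ = 1) :
    ∃ b' : OrthonormalBasis (Fin 8) ℝ V, b'.toBasis.orientation = b.toBasis.orientation ∧
      cayleyForm b' = cayleyForm b ∧ b' 0 = e := by
  -- Coefficients are killed in the order 1, 2, 4, 3, 5, 6, 7. This order ensures that each
  -- compensating plane has both of its coefficients already killed or neither.
  obtain ⟨b₁, o₁, c₁, z₁, -⟩ := cayleyFlag_1_2_3.exists_inner_eq_zero b e ∅ (by decide)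
    (by decide) (by simp)
  obtain ⟨b₂, o₂, c₂, z₂, -⟩ := cayleyFlag_2_4_6.exists_inner_eq_zero b₁ e _ (by decide)
    (by decide) z₁
  obtain ⟨b₃, o₃, c₃, z₃, -⟩ := cayleyFlag_4_3_7.exists_inner_eq_zero b₂ e _ (by decide)
    (by decide) z₂
  obtain ⟨b₄, o₄, c₄, z₄, -⟩ := cayleyFlag_3_1_2.exists_inner_eq_zero b₃ e _ (by decide)
    (by decide) z₃
  obtain ⟨b₅, o₅, c₅, z₅, -⟩ := cayleyFlag_5_1_4.exists_inner_eq_zero b₄ e _ (by decide)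
    (by decide) z₄
  obtain ⟨b₆, o₆, c₆, z₆, -⟩ := cayleyFlag_6_2_4.exists_inner_eq_zero b₅ e _ (by decide)
    (by decide) z₅
  obtain ⟨b₇, o₇, c₇, z₇, n₇⟩ := cayleyFlag_7_3_4.exists_inner_eq_zero b₆ e _ (by decide)
    (by decide) z₆
  refine ⟨b₇, by rw [o₇, o₆, o₅, o₄, o₃, o₂, o₁], by rw [c₇, c₆, c₅, c₄, c₃, c₂, c₁], ?_⟩
  have hz : ∀ k, k ≠ 0 → ⟪b₇ k, e⟫_ℝ = 0 := fun k hk => z₇ k (by revert k; decide)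
  have hsum : e = ⟪b₇ 0, e⟫_ℝ • b₇ 0 := by
    conv_lhs => rw [← b₇.sum_repr' e]
    exact Finset.sum_eq_single 0 (fun k _ hk => by rw [hz k hk, zero_smul]) (by simp)
  -- Only the coefficient along `b₇ 0` is left. It has absolute value 1 and was made nonnegative by
  -- the last rotation.
  have hn := congrArg norm hsum
  rw [norm_smul, he, b₇.norm_eq_one, mul_one, Real.norm_of_nonneg n₇] at hn
  rw [← hn, one_smul] at hsum
  exact hsum.symm

end InvForm

namespace InvForm

/-! ### Independence of the orthonormal basis -/

/-- A symmetric function of `k` indices that vanishes on repeated indices: the sum over all tuples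
is `k!` times the sum over the increasing ones. -/
theorem sum_eq_factorial_mul_sum_orderEmbedding {n k : ℕ} (φ : (Fin k → Fin n) → ℝ)
    (hperm : ∀ f (σ : Equiv.Perm (Fin k)), φ (f ∘ σ) = φ f)
    (hinj : ∀ f, ¬ Function.Injective f → φ f = 0) :
    ∑ f, φ f = (k.factorial : ℝ) * ∑ I : Fin k ↪o Fin n, φ I := by
  classical
  have h1 : ∑ f, φ f = ∑ f ∈ Finset.univ.filter Function.Injective, φ f :=
    (Finset.sum_filter_of_ne fun f _ h => by_contra fun h' => h (hinj f h')).symm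
  have h2 : ∑ x : (Fin k ↪o Fin n) × Equiv.Perm (Fin k), φ x.1 =
      ∑ f ∈ Finset.univ.filter Function.Injective, φ f := by
    refine Finset.sum_bij (fun x _ => x.1 ∘ x.2) ?_ ?_ ?_ ?_
    · intro x _
      simpa using x.1.injective.comp x.2.injective
    · rintro ⟨I, σ⟩ _ ⟨J, τ⟩ _ h
      have hr : I = J := by
        rw [← OrderEmbedding.range_inj, ← σ.surjective.range_comp, h, τ.surjective.range_comp]
      subst hr
      refine Prod.ext rfl (Equiv.ext fun a => I.injective (congrFun h a))
    · intro f hf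
      have hf' : Function.Injective f := by simpa using hf
      have hm : StrictMono (f ∘ Tuple.sort f) :=
        (Tuple.monotone_sort f).strictMono_of_injective (hf'.comp (Tuple.sort f).injective)
      refine ⟨(OrderEmbedding.ofStrictMono _ hm, (Tuple.sort f)⁻¹), Finset.mem_univ _, ?_⟩
      ext a
      simp
    · intro x _
      exact (hperm _ _).symm
  rw [h1, ← h2, Fintype.sum_prod_type]
  simp [Finset.mul_sum, Fintype.card_perm]

variable {V : Type*} [NormedAddCommGroup V] [InnerProductSpace ℝ V]

theorem multilinear_apply_basis {n k : ℕ} (b b' : OrthonormalBasis (Fin n) ℝ V)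
    (α : MultilinearMap ℝ (fun _ : Fin k => V) ℝ) (f : Fin k → Fin n) :
    α (b' ∘ f) = ∑ g : Fin k → Fin n, (∏ a, ⟪b (g a), b' (f a)⟫_ℝ) * α (b ∘ g) := by
  have h : b' ∘ f = fun a => ∑ i, ⟪b i, b' (f a)⟫_ℝ • b i := by
    ext a
    exact (b.sum_repr' _).symm
  rw [h, MultilinearMap.map_sum]
  exact Finset.sum_congr rfl fun g _ => by
    rw [MultilinearMap.map_smul_univ, smul_eq_mul]
    rfl

/-- The transition matrix between orthonormal bases is orthogonal, hence so is its `k`-th tensor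
power (`hδ`). Summing over all tuples instead of increasing ones is what lets the sum of products
factor slot by slot. -/
theorem sum_multilinear_mul_eq {n k : ℕ} (b b' : OrthonormalBasis (Fin n) ℝ V)
    (α β : MultilinearMap ℝ (fun _ : Fin k => V) ℝ) :
    ∑ f : Fin k → Fin n, α (b' ∘ f) * β (b' ∘ f) = ∑ f : Fin k → Fin n, α (b ∘ f) * β (b ∘ f) := by
  classical
  have hδ : ∀ g h : Fin k → Fin n,
      ∑ f : Fin k → Fin n, ((∏ a, ⟪b (g a), b' (f a)⟫_ℝ) * ∏ a, ⟪b (h a), b' (f a)⟫_ℝ) =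
        if g = h then 1 else 0 := by
    intro g h
    simp_rw [← Finset.prod_mul_distrib]
    rw [← Fintype.piFinset_univ, ← Finset.prod_univ_sum (fun _ => Finset.univ)
      fun a j => ⟪b (g a), b' j⟫_ℝ * ⟪b (h a), b' j⟫_ℝ]
    have : ∀ a, ∑ j, ⟪b (g a), b' j⟫_ℝ * ⟪b (h a), b' j⟫_ℝ = if g a = h a then 1 else 0 := by
      intro a
      rw [← orthonormal_iff_ite.mp b.orthonormal, ← b'.sum_inner_mul_inner]
      exact Finset.sum_congr rfl fun j _ => by rw [real_inner_comm (b' j) (b (h a))]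
    simp_rw [this]
    split_ifs with hgh
    · simp [hgh]
    · obtain ⟨a, ha⟩ := Function.ne_iff.mp hgh
      exact Finset.prod_eq_zero (Finset.mem_univ a) (if_neg ha)
  simp_rw [multilinear_apply_basis b b', Finset.sum_mul_sum]
  rw [Finset.sum_comm]
  refine Finset.sum_congr rfl fun g _ => ?_
  rw [Finset.sum_comm]
  calc _ = ∑ h : Fin k → Fin n, (if g = h then 1 else 0) * (α (b ∘ g) * β (b ∘ h)) := by
        refine Finset.sum_congr rfl fun h _ => ?_
        rw [← hδ, Finset.sum_mul]
        exact Finset.sum_congr rfl fun f _ => by ring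
    _ = _ := by simp

/-- The inner product of two forms does not depend on the orthonormal basis. -/
theorem formInner_eq {n k : ℕ} (b b' : OrthonormalBasis (Fin n) ℝ V)
    (α β : V [⋀^Fin k]→ₗ[ℝ] ℝ) : formInner b α β = formInner b' α β := by
  have key : ∀ b : OrthonormalBasis (Fin n) ℝ V, ∑ f : Fin k → Fin n, α (b ∘ f) * β (b ∘ f) =
      (k.factorial : ℝ) * formInner b α β := by
    intro b
    rw [sum_eq_factorial_mul_sum_orderEmbedding fun f => α (b ∘ f) * β (b ∘ f)]
    · rfl
    · intro f σ
      rw [← Function.comp_assoc, AlternatingMap.map_perm, AlternatingMap.map_perm]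
      rcases Int.units_eq_one_or (Equiv.Perm.sign σ) with h | h <;> simp [h]
    · intro f hf
      rw [AlternatingMap.map_eq_zero_of_not_injective _ _ fun h => hf (h.of_comp), zero_mul]
  have h := sum_multilinear_mul_eq b b' α.toMultilinearMap β.toMultilinearMap
  have h' := (key b').symm.trans (h.trans (key b))
  exact (mul_left_cancel₀ (Nat.cast_ne_zero.mpr k.factorial_ne_zero) h').symm

theorem hodgeStar_apply {l k : ℕ} (b : OrthonormalBasis (Fin (l + k)) ℝ V)
    (β : V [⋀^Fin k]→ₗ[ℝ] ℝ) (x : Fin l → V) :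
    hodgeStar l k b β x =
      ∑ I : Fin k ↪o Fin (l + k),
        β (fun a => b (I a)) * contract (fun a => b (I a)) b.toBasis.det x := by
  let ev : V [⋀^Fin l]→ₗ[ℝ] ℝ →+ ℝ :=
    { toFun := fun f => f x
      map_zero' := rfl
      map_add' := fun _ _ => rfl }
  exact map_sum ev _ _

theorem contract_five_three_apply (ω : V [⋀^Fin 8]→ₗ[ℝ] ℝ) (u : Fin 5 → V) (x : Fin 3 → V) :
    contract (l := 3) u ω x = ω ![u 0, u 1, u 2, u 3, u 4, x 0, x 1, x 2] := by
  have hx : x = ![x 0, x 1, x 2] := by ext i; fin_cases i <;> rfl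
  have h : contract (l := 3) u ω x =
      ω (Matrix.vecCons (u 0) (Matrix.vecCons (u 1) (Matrix.vecCons (u 2) (Matrix.vecCons (u 3)
        (Matrix.vecCons (u 4) x))))) := rfl
  rw [h]
  conv_lhs => rw [hx]

theorem contract_three_five_apply (ω : V [⋀^Fin 8]→ₗ[ℝ] ℝ) (u : Fin 5 → V) (x : Fin 3 → V) :
    contract (l := 5) x ω u = ω ![x 0, x 1, x 2, u 0, u 1, u 2, u 3, u 4] := by
  have hu : u = ![u 0, u 1, u 2, u 3, u 4] := by ext i; fin_cases i <;> rfl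
  have h : contract (l := 5) x ω u =
      ω (Matrix.vecCons (x 0) (Matrix.vecCons (x 1) (Matrix.vecCons (x 2) u))) := rfl
  rw [h]
  conv_lhs => rw [hu]

/-- Moving three vectors past five costs `(-1)^15`. The block permutation is the cube of the 8-cycle
`finRotate 8`, which is odd. -/
theorem contract_swap (ω : V [⋀^Fin 8]→ₗ[ℝ] ℝ) (u : Fin 5 → V) (x : Fin 3 → V) :
    contract (l := 3) u ω x = - contract (l := 5) x ω u := by
  rw [contract_five_three_apply, contract_three_five_apply]
  have h := ω.map_perm ![x 0, x 1, x 2, u 0, u 1, u 2, u 3, u 4] (finRotate 8 ^ 3)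
  have hs : Equiv.Perm.sign (finRotate 8 ^ 3) = -1 := by
    rw [map_pow, sign_finRotate]; decide
  rw [hs] at h
  have e : ![x 0, x 1, x 2, u 0, u 1, u 2, u 3, u 4] ∘ (finRotate 8 ^ 3 : Equiv.Perm (Fin 8)) =
      ![u 0, u 1, u 2, u 3, u 4, x 0, x 1, x 2] := by
    ext i
    fin_cases i <;> rfl
  rw [e] at h
  rw [h]
  simp

/-- This writes the star through two objects that are independent of the oriented basis: the inner
product of forms and the volume form. -/
theorem hodgeStar_eq_formInner (b : OrthonormalBasis (Fin 8) ℝ V) (β : V [⋀^Fin 5]→ₗ[ℝ] ℝ)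
    (x : Fin 3 → V) :
    hodgeStar 3 5 b β x = - formInner b β (contract (l := 5) x b.toBasis.det) := by
  rw [hodgeStar_apply, formInner, ← Finset.sum_neg_distrib]
  exact Finset.sum_congr rfl fun I _ => by rw [contract_swap, mul_neg]

/-- The Hodge star does not depend on the oriented orthonormal basis. -/
theorem hodgeStar_eq {b b' : OrthonormalBasis (Fin 8) ℝ V}
    (h : b.toBasis.orientation = b'.toBasis.orientation) (β : V [⋀^Fin 5]→ₗ[ℝ] ℝ) :
    hodgeStar 3 5 b β = hodgeStar 3 5 b' β := by
  ext x
  rw [hodgeStar_eq_formInner, hodgeStar_eq_formInner, formInner_eq b b',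
    (OrthonormalBasis.same_orientation_iff_det_eq_det).mpr h]

/-- The Hodge star on a complementary pair of basis tuples. -/
theorem hodgeStar_apply_basis (b : OrthonormalBasis (Fin 8) ℝ V) (β : V [⋀^Fin 5]→ₗ[ℝ] ℝ)
    (I : Fin 5 → Fin 8) (J : Fin 3 → Fin 8) (hI : StrictMono I)
    (hf : Function.Bijective ![I 0, I 1, I 2, I 3, I 4, J 0, J 1, J 2]) :
    hodgeStar 3 5 b β (b ∘ J) =
      (Equiv.Perm.sign (Equiv.ofBijective _ hf) : ℤ) * β (b ∘ I) := by
  rw [hodgeStar_apply, Finset.sum_eq_single (OrderEmbedding.ofStrictMono I hI)]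
  · have e : ![b (I 0), b (I 1), b (I 2), b (I 3), b (I 4), b (J 0), b (J 1), b (J 2)] =
        b ∘ Equiv.ofBijective _ hf := by
      ext i
      fin_cases i <;> rfl
    rw [contract_five_three_apply]
    simp only [OrderEmbedding.coe_ofStrictMono, Function.comp_apply]
    rw [e, AlternatingMap.map_perm, ← b.coe_toBasis, Module.Basis.det_self, mul_comm]
    simp [Units.smul_def, Function.comp_def]
  · intro K _ hK
    rw [contract_five_three_apply]
    convert mul_zero _
    have e : ![b (K 0), b (K 1), b (K 2), b (K 3), b (K 4), b (J 0), b (J 1), b (J 2)] =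
        b ∘ ![K 0, K 1, K 2, K 3, K 4, J 0, J 1, J 2] := by
      ext i
      fin_cases i <;> rfl
    simp only [Function.comp_apply]
    rw [e]
    -- If no index repeats, then `K` avoids the values of `J` and so takes values among those of
    -- `I`. Both have five values, and increasing tuples with equal range coincide.
    refine AlternatingMap.map_eq_zero_of_not_injective _ _ fun hinj => hK ?_
    have hinj' := hinj.of_comp
    rw [← OrderEmbedding.range_inj]
    have sub : Set.range K ⊆ Set.range I := by
      rintro _ ⟨a, rfl⟩
      obtain ⟨i, hi⟩ := hf.2 (K a)
      have hJ : ∀ c : Fin 3, J c ≠ K a := by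
        intro c hc
        have := @hinj' (Fin.natAdd 5 c) (Fin.castAdd 3 a) (by
          fin_cases c <;> fin_cases a <;> exact hc)
        revert this
        fin_cases c <;> fin_cases a <;> decide
      fin_cases i
      exacts [⟨0, hi⟩, ⟨1, hi⟩, ⟨2, hi⟩, ⟨3, hi⟩, ⟨4, hi⟩, (hJ 0 hi).elim, (hJ 1 hi).elim,
        (hJ 2 hi).elim]
    refine Set.eq_of_subset_of_ncard_le sub ?_ (Set.toFinite _)
    rw [OrderEmbedding.coe_ofStrictMono, Set.ncard_range_of_injective hI.injective,
        Set.ncard_range_of_injective K.injective]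
  · simp

end InvForm

/-! ### The differential on commuting vectors -/

namespace InvForm

section Lie

variable {g : Type*} [LieRing g] [LieAlgebra ℝ g]

theorem d_apply_eq_zero {k : ℕ} (α : g [⋀^Fin (k + 1)]→ₗ[ℝ] ℝ) (x : Fin (k + 2) → g)
    (hx : ∀ i j, ⁅x i, x j⁆ = 0) : d α x = 0 := by
  rw [d_apply]
  refine Finset.sum_eq_zero fun i _ => Finset.sum_eq_zero fun j _ => ?_
  rw [hx, AlternatingMap.map_coord_zero _ 0 rfl, mul_zero]

/-- The differential on a vector followed by commuting vectors. -/
theorem d_apply_vecCons {k : ℕ} (α : g [⋀^Fin (k + 1)]→ₗ[ℝ] ℝ) (e : g) (w : Fin (k + 1) → g)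
    (hw : ∀ i j, ⁅w i, w j⁆ = 0) :
    d α (Matrix.vecCons e w) = - ∑ a, α (Function.update w a ⁅e, w a⁆) := by
  rw [d_apply, Finset.sum_eq_single 0]
  · rw [← Finset.sum_neg_distrib]
    refine Finset.sum_congr (by ext; simp) fun j _ => ?_
    have h1 : (0 : Fin (k + 1)).castSucc.removeNth (Matrix.vecCons e w) = w := by
      ext a
      simp [Fin.removeNth]
    -- Moving the bracket from the front to slot `j` costs `(-1)^j`. Against the sign `(-1)^(j+1)`
    -- in `d` this leaves `-1` for every `j`.
    have h2 : Function.update w j ⁅e, w j⁆ = j.insertNth ⁅e, w j⁆ (j.removeNth w) := by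
      simp
    rw [h1, h2, AlternatingMap.map_insertNth]
    simp [pow_succ]
  · intro i _ hi
    obtain ⟨i, rfl⟩ := Fin.exists_succ_eq.mpr hi
    refine Finset.sum_eq_zero fun j _ => ?_
    have h : ⁅Matrix.vecCons e w i.succ.castSucc, Matrix.vecCons e w j.succ⁆ = 0 := by
      rw [← Fin.succ_castSucc, Matrix.cons_val_succ, Matrix.cons_val_succ, hw]
    rw [h, AlternatingMap.map_coord_zero _ 0 rfl, mul_zero]
  · simp

end Lie

end InvForm

/-! ### Coordinates on the quasi-abelian algebra, and unimodularity -/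

namespace QuasiAbelian

variable {E : Matrix (Fin 7) (Fin 7) ℝ}

theorem lie_eq_zero {x y : QuasiAbelian E} (hx : x.fst = 0) (hy : y.fst = 0) : ⁅x, y⁆ = 0 := by
  rw [ext_iff', fst_bracket, snd_bracket, hx, hy]
  simp [fst_zero, snd_zero]

theorem ofLp_stdBasis (i j : Fin 8) : WithLp.ofLp (stdBasis E i) j = if j = i then 1 else 0 := by
  have h : (EuclideanSpace.basisFun (Fin 8) ℝ i).ofLp j = if j = i then 1 else 0 := by
    simp
  exact h

theorem stdBasis_zero : stdBasis E 0 = mk 1 0 := by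
  rw [ext_iff']
  refine ⟨ofLp_stdBasis 0 0, funext fun i => ?_⟩
  exact (ofLp_stdBasis 0 i.succ).trans (if_neg (Fin.succ_ne_zero i))

theorem stdBasis_succ (i : Fin 7) : stdBasis E i.succ = mk 0 (Pi.single i 1) := by
  rw [ext_iff']
  refine ⟨(ofLp_stdBasis i.succ 0).trans (if_neg (Fin.succ_ne_zero i).symm), funext fun j => ?_⟩
  refine (ofLp_stdBasis i.succ j.succ).trans ?_
  simp [snd_mk, Pi.single_apply]

/-- The inner product in coordinates. -/
theorem inner_eq (x y : QuasiAbelian E) : ⟪x, y⟫_ℝ = x.fst * y.fst + x.snd ⬝ᵥ y.snd := by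
  have h : ⟪x, y⟫_ℝ = ∑ i : Fin 8, WithLp.ofLp x i * WithLp.ofLp y i := by
    refine (PiLp.inner_apply (𝕜 := ℝ) (x : EuclideanSpace ℝ (Fin 8)) y).trans ?_
    exact Finset.sum_congr rfl fun i _ => mul_comm _ _
  rw [h, Fin.sum_univ_succ]
  rfl

theorem fst_sum {ι : Type*} (s : Finset ι) (f : ι → QuasiAbelian E) :
    (∑ i ∈ s, f i).fst = ∑ i ∈ s, (f i).fst := by
  classical
  induction s using Finset.induction_on with
  | empty => rfl
  | insert a s ha ih => rw [Finset.sum_insert ha, Finset.sum_insert ha, ← ih]; rfl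

theorem snd_sum {ι : Type*} (s : Finset ι) (f : ι → QuasiAbelian E) :
    (∑ i ∈ s, f i).snd = ∑ i ∈ s, (f i).snd := by
  classical
  induction s using Finset.induction_on with
  | empty => rfl
  | insert a s ha ih => rw [Finset.sum_insert ha, Finset.sum_insert ha, ← ih]; rfl

/-- The vectors `e₁, …, e₇` commute, so only brackets with `e₀` contribute, and `ad(e₀)` acts on a
top form of `ℝ⁷` by its trace. -/
theorem d_top_apply (α : QuasiAbelian E [⋀^Fin 7]→ₗ[ℝ] ℝ) :
    InvForm.d α (stdBasis E) = - (E.trace * α fun i => stdBasis E i.succ) := by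
  have e : ⇑(stdBasis E) = Matrix.vecCons (stdBasis E 0) fun i => stdBasis E i.succ := by
    ext i
    exact Fin.cases rfl (fun _ => rfl) i
  rw [e, InvForm.d_apply_vecCons _ _ _ fun i j => lie_eq_zero (by rw [stdBasis_succ, fst_mk])
    (by rw [stdBasis_succ, fst_mk]), Matrix.trace, Finset.sum_mul]
  congr 1
  refine Finset.sum_congr rfl fun a _ => ?_
  have h : ⁅stdBasis E 0, stdBasis E a.succ⁆ = ∑ p, E p a • stdBasis E p.succ := by
    rw [ext_iff']
    rw [fst_sum, snd_sum, fst_bracket, snd_bracket]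
    simp only [stdBasis_zero, stdBasis_succ, fst_smul, snd_smul, fst_mk, snd_mk]
    refine ⟨by simp, ?_⟩
    ext i
    simp [Finset.sum_apply, Pi.single_apply]
  rw [h, AlternatingMap.map_update_sum, Finset.sum_eq_single a]
  · rw [AlternatingMap.map_update_smul, Function.update_eq_self]
    rfl
  · intro p _ hp
    rw [AlternatingMap.map_update_smul]
    rw [AlternatingMap.map_eq_zero_of_eq _ _ (i := a) (j := p) (by simp [hp]) hp.symm, smul_zero]
  · simp

theorem isUnimodular_iff : IsUnimodular E ↔ E.trace = 0 := by
  have hdet : (stdBasis E).toBasis.det (stdBasis E) = 1 := by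
    rw [← OrthonormalBasis.coe_toBasis, Module.Basis.det_self]
  constructor
  · intro h
    by_contra ht
    -- The primitive is the contraction of the volume form with `e₀`, normalized by the factor that
    -- `d_top_apply` produces.
    refine h ⟨(-E.trace⁻¹) • (stdBasis E).toBasis.det.curryLeft (stdBasis E 0), ?_⟩
    rw [AlternatingMap.eq_smul_basis_det (stdBasis E).toBasis (InvForm.d _),
      OrthonormalBasis.coe_toBasis, d_top_apply]
    have e : (Matrix.vecCons (stdBasis E 0) fun i => stdBasis E i.succ) = stdBasis E := by
      ext i
      exact Fin.cases rfl (fun _ => rfl) i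
    rw [AlternatingMap.smul_apply, AlternatingMap.curryLeft_apply_apply, e, hdet]
    have : -(E.trace * (-E.trace⁻¹ • (1 : ℝ))) = 1 := by
      rw [smul_eq_mul]
      field_simp
    rw [this, one_smul]
  · rintro h ⟨α, hα⟩
    have := d_top_apply α
    rw [hα, hdet, h] at this
    norm_num at this

end QuasiAbelian

/-! ### Components of `⋆dΩ` in an adapted frame -/

namespace QuasiAbelian

open InvForm

variable {E : Matrix (Fin 7) (Fin 7) ℝ}

/-- A positively oriented orthonormal frame that starts with `e₀`. -/
structure IsAdapted (b : OrthonormalBasis (Fin 8) ℝ (QuasiAbelian E)) : Prop where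
  zero : b 0 = stdBasis E 0
  orientation : b.toBasis.orientation = (stdBasis E).toBasis.orientation

/-- The entries of the matrix of `ad(b₀)` in a frame `b`. -/
noncomputable def adEntry (b : OrthonormalBasis (Fin 8) ℝ (QuasiAbelian E)) (p i : Fin 8) : ℝ :=
  ⟪b p, ⁅b 0, b i⁆⟫_ℝ

theorem inner_lie (b : OrthonormalBasis (Fin 8) ℝ (QuasiAbelian E)) (p i : Fin 8) :
    ⟪b p, ⁅b 0, b i⁆⟫_ℝ = adEntry b p i := rfl

namespace IsAdapted

variable {b : OrthonormalBasis (Fin 8) ℝ (QuasiAbelian E)}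

theorem inner_zero (h : IsAdapted b) (x : QuasiAbelian E) : ⟪b 0, x⟫_ℝ = x.fst := by
  rw [h.zero, stdBasis_zero, inner_eq, fst_mk, snd_mk]
  simp

theorem fst_eq_zero (h : IsAdapted b) {i : Fin 8} (hi : i ≠ 0) : (b i).fst = 0 := by
  rw [← h.inner_zero, b.inner_eq_ite, if_neg hi.symm]

theorem inner_lie_zero (h : IsAdapted b) (i : Fin 8) : ⟪b 0, ⁅b 0, b i⁆⟫_ℝ = 0 := by
  rw [h.inner_zero, fst_bracket]

theorem starD_eq (h : IsAdapted b) (Ω : QuasiAbelian E [⋀^Fin 4]→ₗ[ℝ] ℝ) :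
    starD Ω = hodgeStar 3 5 b (d Ω) := hodgeStar_eq h.orientation.symm _

end IsAdapted

/-- A component of `⋆dΩ` is, up to sign, the value of `dΩ` on the complementary basis vectors. These
include `b 0`, so `d` acts as minus the derivation induced by `ad(b 0)`. The permutation sign is
phrased as a product over inversions so that it can be decided for explicit indices. -/
theorem starD_frame {b : OrthonormalBasis (Fin 8) ℝ (QuasiAbelian E)} (h : IsAdapted b)
    {Ω : QuasiAbelian E [⋀^Fin 4]→ₗ[ℝ] ℝ} (i₁ i₂ i₃ i₄ j₁ j₂ j₃ : Fin 8)
    (hI : 0 < i₁ ∧ i₁ < i₂ ∧ i₂ < i₃ ∧ i₃ < i₄)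
    (hf : Function.Bijective ![0, i₁, i₂, i₃, i₄, j₁, j₂, j₃]) (s : ℤˣ)
    (hs : (∏ i, ∏ j ∈ Finset.Ioi i, if ![0, i₁, i₂, i₃, i₄, j₁, j₂, j₃] i <
      ![0, i₁, i₂, i₃, i₄, j₁, j₂, j₃] j then (1 : ℤˣ) else -1) = s) :
    starD Ω ![b j₁, b j₂, b j₃] = -(s : ℤ) * (Ω ![⁅b 0, b i₁⁆, b i₂, b i₃, b i₄] +
      Ω ![b i₁, ⁅b 0, b i₂⁆, b i₃, b i₄] + Ω ![b i₁, b i₂, ⁅b 0, b i₃⁆, b i₄] +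
      Ω ![b i₁, b i₂, b i₃, ⁅b 0, b i₄⁆]) := by
  obtain ⟨h1, h2, h3, h4⟩ := hI
  have hJ : ![b j₁, b j₂, b j₃] = b ∘ ![j₁, j₂, j₃] := by
    ext i; fin_cases i <;> rfl
  have hm : StrictMono ![0, i₁, i₂, i₃, i₄] := by
    rw [Fin.strictMono_iff_lt_succ]
    intro i
    fin_cases i
    exacts [h1, h2, h3, h4]
  have hI' : b ∘ ![0, i₁, i₂, i₃, i₄] = Matrix.vecCons (b 0) ![b i₁, b i₂, b i₃, b i₄] := by
    ext i; fin_cases i <;> rfl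
  have hfst : ∀ a, (![b i₁, b i₂, b i₃, b i₄] a).fst = 0 := by
    intro a
    fin_cases a
    exacts [h.fst_eq_zero h1.ne', h.fst_eq_zero (h1.trans h2).ne',
      h.fst_eq_zero (h1.trans (h2.trans h3)).ne',
      h.fst_eq_zero (h1.trans (h2.trans (h3.trans h4))).ne']
  have hsign : Equiv.Perm.sign (Equiv.ofBijective _ hf) = s := by
    rw [Equiv.Perm.sign_eq_prod_prod_Ioi, ← hs]
    rfl
  rw [h.starD_eq, hJ, hodgeStar_apply_basis b (d Ω) _ ![j₁, j₂, j₃] hm hf, hI',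
    d_apply_vecCons _ _ _ fun i j => lie_eq_zero (hfst i) (hfst j)]
  have e0 : Function.update ![b i₁, b i₂, b i₃, b i₄] 0 ⁅b 0, b i₁⁆ =
    ![⁅b 0, b i₁⁆, b i₂, b i₃, b i₄] := by ext i; fin_cases i <;> rfl
  have e1 : Function.update ![b i₁, b i₂, b i₃, b i₄] 1 ⁅b 0, b i₂⁆ =
    ![b i₁, ⁅b 0, b i₂⁆, b i₃, b i₄] := by ext i; fin_cases i <;> rfl
  have e2 : Function.update ![b i₁, b i₂, b i₃, b i₄] 2 ⁅b 0, b i₃⁆ =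
    ![b i₁, b i₂, ⁅b 0, b i₃⁆, b i₄] := by ext i; fin_cases i <;> rfl
  have e3 : Function.update ![b i₁, b i₂, b i₃, b i₄] 3 ⁅b 0, b i₄⁆ =
    ![b i₁, b i₂, b i₃, ⁅b 0, b i₄⁆] := by ext i; fin_cases i <;> rfl
  rw [Fin.sum_univ_four]
  simp only [Matrix.cons_val]
  rw [e0, e1, e2, e3]
  have hsign' : ((Equiv.Perm.sign (Equiv.ofBijective _ hf) : ℤ) : ℝ) = ((s : ℤ) : ℝ) := by
    rw [hsign]
  rw [neg_mul, ← mul_neg]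
  exact congrArg (· * _) hsign'

/-- As `ℝ⁷` is abelian, `dΩ` vanishes on five vectors of `ℝ⁷`. It is thus divisible by `e⁰`, and its
star is killed by contraction with `e₀`. -/
theorem starD_frame_zero {b : OrthonormalBasis (Fin 8) ℝ (QuasiAbelian E)} (h : IsAdapted b)
    {Ω : QuasiAbelian E [⋀^Fin 4]→ₗ[ℝ] ℝ} (j k : Fin 8) :
    starD Ω ![b 0, b j, b k] = 0 := by
  rw [h.starD_eq, hodgeStar_apply]
  refine Finset.sum_eq_zero fun I _ => ?_
  by_cases hI : ∀ a, I a ≠ 0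
  · rw [d_apply_eq_zero _ _ fun i j => lie_eq_zero (h.fst_eq_zero (hI i)) (h.fst_eq_zero (hI j)),
      zero_mul]
  · push Not at hI
    obtain ⟨a, ha⟩ := hI
    rw [contract_five_three_apply]
    convert mul_zero _
    refine AlternatingMap.map_eq_zero_of_eq _ _ (i := Fin.castAdd 3 a) (j := 5) ?_ ?_
    · fin_cases a <;> simp_all
    · fin_cases a <;> decide

set_option maxHeartbeats 1000000 in
/-- The components of `⋆dΩ` in an adapted Cayley frame. -/
theorem starD_components {b : OrthonormalBasis (Fin 8) ℝ (QuasiAbelian E)} (h : IsAdapted b) :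
    starD (cayleyForm b) ![b 1, b 2, b 3] =
      -adEntry b 4 4 - adEntry b 5 5 - adEntry b 6 6 - adEntry b 7 7 ∧
    starD (cayleyForm b) ![b 1, b 2, b 4] =
      -adEntry b 1 6 + adEntry b 2 5 + adEntry b 4 3 ∧
    starD (cayleyForm b) ![b 1, b 2, b 5] =
      adEntry b 1 7 - adEntry b 2 4 + adEntry b 5 3 ∧
    starD (cayleyForm b) ![b 1, b 2, b 6] =
      adEntry b 1 4 + adEntry b 2 7 + adEntry b 6 3 ∧
    starD (cayleyForm b) ![b 1, b 2, b 7] =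
      -adEntry b 1 5 - adEntry b 2 6 + adEntry b 7 3 ∧
    starD (cayleyForm b) ![b 1, b 3, b 4] =
      -adEntry b 1 7 + adEntry b 3 5 - adEntry b 4 2 ∧
    starD (cayleyForm b) ![b 1, b 3, b 5] =
      -adEntry b 1 6 - adEntry b 3 4 - adEntry b 5 2 ∧
    starD (cayleyForm b) ![b 1, b 3, b 6] =
      adEntry b 1 5 + adEntry b 3 7 - adEntry b 6 2 ∧
    starD (cayleyForm b) ![b 1, b 3, b 7] =
      adEntry b 1 4 - adEntry b 3 6 - adEntry b 7 2 ∧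
    starD (cayleyForm b) ![b 1, b 4, b 5] =
      adEntry b 2 2 + adEntry b 3 3 + adEntry b 6 6 + adEntry b 7 7 ∧
    starD (cayleyForm b) ![b 1, b 4, b 6] =
      -adEntry b 1 2 + adEntry b 4 7 - adEntry b 6 5 ∧
    starD (cayleyForm b) ![b 1, b 4, b 7] =
      -adEntry b 1 3 - adEntry b 4 6 - adEntry b 7 5 ∧
    starD (cayleyForm b) ![b 1, b 5, b 6] =
      -adEntry b 1 3 + adEntry b 5 7 + adEntry b 6 4 ∧
    starD (cayleyForm b) ![b 1, b 5, b 7] =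
      adEntry b 1 2 - adEntry b 5 6 + adEntry b 7 4 ∧
    starD (cayleyForm b) ![b 1, b 6, b 7] =
      adEntry b 2 2 + adEntry b 3 3 + adEntry b 4 4 + adEntry b 5 5 ∧
    starD (cayleyForm b) ![b 2, b 3, b 4] =
      -adEntry b 2 7 + adEntry b 3 6 + adEntry b 4 1 ∧
    starD (cayleyForm b) ![b 2, b 3, b 5] =
      -adEntry b 2 6 - adEntry b 3 7 + adEntry b 5 1 ∧
    starD (cayleyForm b) ![b 2, b 3, b 6] =
      adEntry b 2 5 - adEntry b 3 4 + adEntry b 6 1 ∧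
    starD (cayleyForm b) ![b 2, b 3, b 7] =
      adEntry b 2 4 + adEntry b 3 5 + adEntry b 7 1 ∧
    starD (cayleyForm b) ![b 2, b 4, b 5] =
      -adEntry b 2 1 - adEntry b 4 7 - adEntry b 5 6 ∧
    starD (cayleyForm b) ![b 2, b 4, b 6] =
      adEntry b 1 1 + adEntry b 3 3 + adEntry b 5 5 + adEntry b 7 7 ∧
    starD (cayleyForm b) ![b 2, b 4, b 7] =
      -adEntry b 2 3 + adEntry b 4 5 - adEntry b 7 6 ∧
    starD (cayleyForm b) ![b 2, b 5, b 6] =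
      -adEntry b 2 3 - adEntry b 5 4 + adEntry b 6 7 ∧
    starD (cayleyForm b) ![b 2, b 5, b 7] =
      -adEntry b 1 1 - adEntry b 3 3 - adEntry b 4 4 - adEntry b 6 6 ∧
    starD (cayleyForm b) ![b 2, b 6, b 7] =
      -adEntry b 2 1 + adEntry b 6 5 + adEntry b 7 4 ∧
    starD (cayleyForm b) ![b 3, b 4, b 5] =
      -adEntry b 3 1 + adEntry b 4 6 - adEntry b 5 7 ∧
    starD (cayleyForm b) ![b 3, b 4, b 6] =
      -adEntry b 3 2 - adEntry b 4 5 - adEntry b 6 7 ∧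
    starD (cayleyForm b) ![b 3, b 4, b 7] =
      adEntry b 1 1 + adEntry b 2 2 + adEntry b 5 5 + adEntry b 6 6 ∧
    starD (cayleyForm b) ![b 3, b 5, b 6] =
      adEntry b 1 1 + adEntry b 2 2 + adEntry b 4 4 + adEntry b 7 7 ∧
    starD (cayleyForm b) ![b 3, b 5, b 7] =
      adEntry b 3 2 - adEntry b 5 4 - adEntry b 7 6 ∧
    starD (cayleyForm b) ![b 3, b 6, b 7] =
      -adEntry b 3 1 - adEntry b 6 4 + adEntry b 7 5 ∧
    starD (cayleyForm b) ![b 4, b 5, b 6] =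
      -adEntry b 4 3 + adEntry b 5 2 - adEntry b 6 1 ∧
    starD (cayleyForm b) ![b 4, b 5, b 7] =
      adEntry b 4 2 + adEntry b 5 3 - adEntry b 7 1 ∧
    starD (cayleyForm b) ![b 4, b 6, b 7] =
      -adEntry b 4 1 + adEntry b 6 3 - adEntry b 7 2 ∧
    starD (cayleyForm b) ![b 5, b 6, b 7] =
      -adEntry b 5 1 - adEntry b 6 2 - adEntry b 7 3 := by
  refine ⟨?_, ?_, ?_, ?_, ?_, ?_, ?_, ?_, ?_, ?_, ?_, ?_, ?_, ?_, ?_, ?_, ?_, ?_, ?_, ?_, ?_,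
      ?_, ?_, ?_, ?_, ?_, ?_, ?_, ?_, ?_, ?_, ?_, ?_, ?_, ?_⟩
  -- The first four indices complement the triple in `1, …, 7`. The explicit unit is the sign of the
  -- permutation that lists `0`, these four and the triple.
  · rw [starD_frame h 4 5 6 7 1 2 3 (by decide) (by decide) 1 (by decide)]
    simp [cayleyForm_apply, cayleyPoly, det4, h.inner_lie_zero, inner_lie]
    ring
  · rw [starD_frame h 3 5 6 7 1 2 4 (by decide) (by decide) (-1) (by decide)]
    simp [cayleyForm_apply, cayleyPoly, det4, h.inner_lie_zero, inner_lie]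
    ring
  · rw [starD_frame h 3 4 6 7 1 2 5 (by decide) (by decide) 1 (by decide)]
    simp [cayleyForm_apply, cayleyPoly, det4, h.inner_lie_zero, inner_lie]
    ring
  · rw [starD_frame h 3 4 5 7 1 2 6 (by decide) (by decide) (-1) (by decide)]
    simp [cayleyForm_apply, cayleyPoly, det4, h.inner_lie_zero, inner_lie]
    ring
  · rw [starD_frame h 3 4 5 6 1 2 7 (by decide) (by decide) 1 (by decide)]
    simp [cayleyForm_apply, cayleyPoly, det4, h.inner_lie_zero, inner_lie]
    ring
  · rw [starD_frame h 2 5 6 7 1 3 4 (by decide) (by decide) 1 (by decide)]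
    simp [cayleyForm_apply, cayleyPoly, det4, h.inner_lie_zero, inner_lie]
    ring
  · rw [starD_frame h 2 4 6 7 1 3 5 (by decide) (by decide) (-1) (by decide)]
    simp [cayleyForm_apply, cayleyPoly, det4, h.inner_lie_zero, inner_lie]
    ring
  · rw [starD_frame h 2 4 5 7 1 3 6 (by decide) (by decide) 1 (by decide)]
    simp [cayleyForm_apply, cayleyPoly, det4, h.inner_lie_zero, inner_lie]
    ring
  · rw [starD_frame h 2 4 5 6 1 3 7 (by decide) (by decide) (-1) (by decide)]
    simp [cayleyForm_apply, cayleyPoly, det4, h.inner_lie_zero, inner_lie]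
    ring
  · rw [starD_frame h 2 3 6 7 1 4 5 (by decide) (by decide) 1 (by decide)]
    simp [cayleyForm_apply, cayleyPoly, det4, h.inner_lie_zero, inner_lie]
    ring
  · rw [starD_frame h 2 3 5 7 1 4 6 (by decide) (by decide) (-1) (by decide)]
    simp [cayleyForm_apply, cayleyPoly, det4, h.inner_lie_zero, inner_lie]
    ring
  · rw [starD_frame h 2 3 5 6 1 4 7 (by decide) (by decide) 1 (by decide)]
    simp [cayleyForm_apply, cayleyPoly, det4, h.inner_lie_zero, inner_lie]
    ring
  · rw [starD_frame h 2 3 4 7 1 5 6 (by decide) (by decide) 1 (by decide)]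
    simp [cayleyForm_apply, cayleyPoly, det4, h.inner_lie_zero, inner_lie]
    ring
  · rw [starD_frame h 2 3 4 6 1 5 7 (by decide) (by decide) (-1) (by decide)]
    simp [cayleyForm_apply, cayleyPoly, det4, h.inner_lie_zero, inner_lie]
    ring
  · rw [starD_frame h 2 3 4 5 1 6 7 (by decide) (by decide) 1 (by decide)]
    simp [cayleyForm_apply, cayleyPoly, det4, h.inner_lie_zero, inner_lie]
    ring
  · rw [starD_frame h 1 5 6 7 2 3 4 (by decide) (by decide) (-1) (by decide)]
    simp [cayleyForm_apply, cayleyPoly, det4, h.inner_lie_zero, inner_lie]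
    ring
  · rw [starD_frame h 1 4 6 7 2 3 5 (by decide) (by decide) 1 (by decide)]
    simp [cayleyForm_apply, cayleyPoly, det4, h.inner_lie_zero, inner_lie]
    ring
  · rw [starD_frame h 1 4 5 7 2 3 6 (by decide) (by decide) (-1) (by decide)]
    simp [cayleyForm_apply, cayleyPoly, det4, h.inner_lie_zero, inner_lie]
    ring
  · rw [starD_frame h 1 4 5 6 2 3 7 (by decide) (by decide) 1 (by decide)]
    simp [cayleyForm_apply, cayleyPoly, det4, h.inner_lie_zero, inner_lie]
    ring
  · rw [starD_frame h 1 3 6 7 2 4 5 (by decide) (by decide) (-1) (by decide)]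
    simp [cayleyForm_apply, cayleyPoly, det4, h.inner_lie_zero, inner_lie]
    ring
  · rw [starD_frame h 1 3 5 7 2 4 6 (by decide) (by decide) 1 (by decide)]
    simp [cayleyForm_apply, cayleyPoly, det4, h.inner_lie_zero, inner_lie]
    ring
  · rw [starD_frame h 1 3 5 6 2 4 7 (by decide) (by decide) (-1) (by decide)]
    simp [cayleyForm_apply, cayleyPoly, det4, h.inner_lie_zero, inner_lie]
    ring
  · rw [starD_frame h 1 3 4 7 2 5 6 (by decide) (by decide) (-1) (by decide)]
    simp [cayleyForm_apply, cayleyPoly, det4, h.inner_lie_zero, inner_lie]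
    ring
  · rw [starD_frame h 1 3 4 6 2 5 7 (by decide) (by decide) 1 (by decide)]
    simp [cayleyForm_apply, cayleyPoly, det4, h.inner_lie_zero, inner_lie]
    ring
  · rw [starD_frame h 1 3 4 5 2 6 7 (by decide) (by decide) (-1) (by decide)]
    simp [cayleyForm_apply, cayleyPoly, det4, h.inner_lie_zero, inner_lie]
    ring
  · rw [starD_frame h 1 2 6 7 3 4 5 (by decide) (by decide) 1 (by decide)]
    simp [cayleyForm_apply, cayleyPoly, det4, h.inner_lie_zero, inner_lie]
    ring
  · rw [starD_frame h 1 2 5 7 3 4 6 (by decide) (by decide) (-1) (by decide)]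
    simp [cayleyForm_apply, cayleyPoly, det4, h.inner_lie_zero, inner_lie]
    ring
  · rw [starD_frame h 1 2 5 6 3 4 7 (by decide) (by decide) 1 (by decide)]
    simp [cayleyForm_apply, cayleyPoly, det4, h.inner_lie_zero, inner_lie]
    ring
  · rw [starD_frame h 1 2 4 7 3 5 6 (by decide) (by decide) 1 (by decide)]
    simp [cayleyForm_apply, cayleyPoly, det4, h.inner_lie_zero, inner_lie]
    ring
  · rw [starD_frame h 1 2 4 6 3 5 7 (by decide) (by decide) (-1) (by decide)]
    simp [cayleyForm_apply, cayleyPoly, det4, h.inner_lie_zero, inner_lie]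
    ring
  · rw [starD_frame h 1 2 4 5 3 6 7 (by decide) (by decide) 1 (by decide)]
    simp [cayleyForm_apply, cayleyPoly, det4, h.inner_lie_zero, inner_lie]
    ring
  · rw [starD_frame h 1 2 3 7 4 5 6 (by decide) (by decide) (-1) (by decide)]
    simp [cayleyForm_apply, cayleyPoly, det4, h.inner_lie_zero, inner_lie]
    ring
  · rw [starD_frame h 1 2 3 6 4 5 7 (by decide) (by decide) 1 (by decide)]
    simp [cayleyForm_apply, cayleyPoly, det4, h.inner_lie_zero, inner_lie]
    ring
  · rw [starD_frame h 1 2 3 5 4 6 7 (by decide) (by decide) (-1) (by decide)]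
    simp [cayleyForm_apply, cayleyPoly, det4, h.inner_lie_zero, inner_lie]
    ring
  · rw [starD_frame h 1 2 3 4 5 6 7 (by decide) (by decide) 1 (by decide)]
    simp [cayleyForm_apply, cayleyPoly, det4, h.inner_lie_zero, inner_lie]
    ring

end QuasiAbelian

/-! ### Components of the elements of `Λ³₈` -/

namespace InvForm

variable {V : Type*} [NormedAddCommGroup V] [InnerProductSpace ℝ V]

/-- Each triple of frame vectors has a signed frame vector as its triple cross product, so every
component of `i(x)Ω` is a single coordinate of `x`. -/
theorem cayleyForm_components (b : OrthonormalBasis (Fin 8) ℝ V) (x : V) :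
    cayleyForm b ![x, b 1, b 2, b 3] = ⟪b 0, x⟫_ℝ ∧
    cayleyForm b ![x, b 1, b 2, b 4] = ⟪b 7, x⟫_ℝ ∧
    cayleyForm b ![x, b 1, b 2, b 5] = ⟪b 6, x⟫_ℝ ∧
    cayleyForm b ![x, b 1, b 2, b 6] = -⟪b 5, x⟫_ℝ ∧
    cayleyForm b ![x, b 1, b 2, b 7] = -⟪b 4, x⟫_ℝ ∧
    cayleyForm b ![x, b 1, b 3, b 4] = -⟪b 6, x⟫_ℝ ∧
    cayleyForm b ![x, b 1, b 3, b 5] = ⟪b 7, x⟫_ℝ ∧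
    cayleyForm b ![x, b 1, b 3, b 6] = ⟪b 4, x⟫_ℝ ∧
    cayleyForm b ![x, b 1, b 3, b 7] = -⟪b 5, x⟫_ℝ ∧
    cayleyForm b ![x, b 1, b 4, b 5] = -⟪b 0, x⟫_ℝ ∧
    cayleyForm b ![x, b 1, b 4, b 6] = -⟪b 3, x⟫_ℝ ∧
    cayleyForm b ![x, b 1, b 4, b 7] = ⟪b 2, x⟫_ℝ ∧
    cayleyForm b ![x, b 1, b 5, b 6] = ⟪b 2, x⟫_ℝ ∧
    cayleyForm b ![x, b 1, b 5, b 7] = ⟪b 3, x⟫_ℝ ∧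
    cayleyForm b ![x, b 1, b 6, b 7] = -⟪b 0, x⟫_ℝ ∧
    cayleyForm b ![x, b 2, b 3, b 4] = ⟪b 5, x⟫_ℝ ∧
    cayleyForm b ![x, b 2, b 3, b 5] = -⟪b 4, x⟫_ℝ ∧
    cayleyForm b ![x, b 2, b 3, b 6] = ⟪b 7, x⟫_ℝ ∧
    cayleyForm b ![x, b 2, b 3, b 7] = -⟪b 6, x⟫_ℝ ∧
    cayleyForm b ![x, b 2, b 4, b 5] = ⟪b 3, x⟫_ℝ ∧
    cayleyForm b ![x, b 2, b 4, b 6] = -⟪b 0, x⟫_ℝ ∧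
    cayleyForm b ![x, b 2, b 4, b 7] = -⟪b 1, x⟫_ℝ ∧
    cayleyForm b ![x, b 2, b 5, b 6] = -⟪b 1, x⟫_ℝ ∧
    cayleyForm b ![x, b 2, b 5, b 7] = ⟪b 0, x⟫_ℝ ∧
    cayleyForm b ![x, b 2, b 6, b 7] = ⟪b 3, x⟫_ℝ ∧
    cayleyForm b ![x, b 3, b 4, b 5] = -⟪b 2, x⟫_ℝ ∧
    cayleyForm b ![x, b 3, b 4, b 6] = ⟪b 1, x⟫_ℝ ∧
    cayleyForm b ![x, b 3, b 4, b 7] = -⟪b 0, x⟫_ℝ ∧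
    cayleyForm b ![x, b 3, b 5, b 6] = -⟪b 0, x⟫_ℝ ∧
    cayleyForm b ![x, b 3, b 5, b 7] = -⟪b 1, x⟫_ℝ ∧
    cayleyForm b ![x, b 3, b 6, b 7] = -⟪b 2, x⟫_ℝ ∧
    cayleyForm b ![x, b 4, b 5, b 6] = -⟪b 7, x⟫_ℝ ∧
    cayleyForm b ![x, b 4, b 5, b 7] = ⟪b 6, x⟫_ℝ ∧
    cayleyForm b ![x, b 4, b 6, b 7] = -⟪b 5, x⟫_ℝ ∧
    cayleyForm b ![x, b 5, b 6, b 7] = ⟪b 4, x⟫_ℝ := by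
  refine ⟨?_, ?_, ?_, ?_, ?_, ?_, ?_, ?_, ?_, ?_, ?_, ?_, ?_, ?_, ?_, ?_, ?_, ?_, ?_, ?_, ?_,
      ?_, ?_, ?_, ?_, ?_, ?_, ?_, ?_, ?_, ?_, ?_, ?_, ?_, ?_⟩ <;>
    simp [cayleyForm_apply, cayleyPoly, det4]

/-- These seven components suffice to read off the coordinates of `x` orthogonal to `b 0`. -/
theorem cayleyForm_components_zero (b : OrthonormalBasis (Fin 8) ℝ V) (x : V) :
    cayleyForm b ![x, b 0, b 2, b 3] = -⟪b 1, x⟫_ℝ ∧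
    cayleyForm b ![x, b 0, b 1, b 3] = ⟪b 2, x⟫_ℝ ∧
    cayleyForm b ![x, b 0, b 1, b 2] = -⟪b 3, x⟫_ℝ ∧
    cayleyForm b ![x, b 0, b 1, b 5] = -⟪b 4, x⟫_ℝ ∧
    cayleyForm b ![x, b 0, b 1, b 4] = ⟪b 5, x⟫_ℝ ∧
    cayleyForm b ![x, b 0, b 1, b 7] = -⟪b 6, x⟫_ℝ ∧
    cayleyForm b ![x, b 0, b 1, b 6] = ⟪b 7, x⟫_ℝ := by
  refine ⟨?_, ?_, ?_, ?_, ?_, ?_, ?_⟩ <;>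
    simp [cayleyForm_apply, cayleyPoly, det4]

end InvForm

/-! ### The linear system for the torsion -/

namespace QuasiAbelian

/-- Twice the component in `Λ²₇` of the skew-symmetric part of an endomorphism of `ℝ⁷`: it vanishes
when the skew-symmetric part lies in the Lie algebra of `G₂`. -/
def g2Part (M : Matrix (Fin 7) (Fin 7) ℝ) : Fin 7 → ℝ :=
  ![
    M 1 2 - M 2 1 - M 3 4 + M 4 3 - M 5 6 + M 6 5,
    -M 0 2 + M 2 0 - M 3 5 + M 4 6 + M 5 3 - M 6 4,
    M 0 1 - M 1 0 - M 3 6 - M 4 5 + M 5 4 + M 6 3,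
    M 0 4 + M 1 5 + M 2 6 - M 4 0 - M 5 1 - M 6 2,
    -M 0 3 - M 1 6 + M 2 5 + M 3 0 - M 5 2 + M 6 1,
    M 0 6 - M 1 3 - M 2 4 + M 3 1 + M 4 2 - M 6 0,
    -M 0 5 + M 1 4 - M 2 3 + M 3 2 - M 4 1 + M 5 0]

-- These are the 35 components of `⋆dΩ = -4h i(b 0)Ω`, where matrix index `i` stands for the frame
-- vector with index `i + 1`. The seven diagonal equations say that the four diagonal entries off
-- each line of a Fano plane sum to `4h`, which forces every one to equal `h`. The other 28 amount
-- to the vanishing of the 21 off-diagonal symmetric entries and the seven coordinates of `g2Part`.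
set_option maxHeartbeats 1000000 in
theorem torsion_linear_system (M : Matrix (Fin 7) (Fin 7) ℝ) (h : ℝ) :
    (
      -M 3 3 - M 4 4 - M 5 5 - M 6 6 = (-4 * h) ∧
      -M 0 5 + M 1 4 + M 3 2 = 0 ∧
      M 0 6 - M 1 3 + M 4 2 = 0 ∧
      M 0 3 + M 1 6 + M 5 2 = 0 ∧
      -M 0 4 - M 1 5 + M 6 2 = 0 ∧
      -M 0 6 + M 2 4 - M 3 1 = 0 ∧
      -M 0 5 - M 2 3 - M 4 1 = 0 ∧
      M 0 4 + M 2 6 - M 5 1 = 0 ∧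
      M 0 3 - M 2 5 - M 6 1 = 0 ∧
      M 1 1 + M 2 2 + M 5 5 + M 6 6 = -(-4 * h) ∧
      -M 0 1 + M 3 6 - M 5 4 = 0 ∧
      -M 0 2 - M 3 5 - M 6 4 = 0 ∧
      -M 0 2 + M 4 6 + M 5 3 = 0 ∧
      M 0 1 - M 4 5 + M 6 3 = 0 ∧
      M 1 1 + M 2 2 + M 3 3 + M 4 4 = -(-4 * h) ∧
      -M 1 6 + M 2 5 + M 3 0 = 0 ∧
      -M 1 5 - M 2 6 + M 4 0 = 0 ∧
      M 1 4 - M 2 3 + M 5 0 = 0 ∧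
      M 1 3 + M 2 4 + M 6 0 = 0 ∧
      -M 1 0 - M 3 6 - M 4 5 = 0 ∧
      M 0 0 + M 2 2 + M 4 4 + M 6 6 = -(-4 * h) ∧
      -M 1 2 + M 3 4 - M 6 5 = 0 ∧
      -M 1 2 - M 4 3 + M 5 6 = 0 ∧
      -M 0 0 - M 2 2 - M 3 3 - M 5 5 = (-4 * h) ∧
      -M 1 0 + M 5 4 + M 6 3 = 0 ∧
      -M 2 0 + M 3 5 - M 4 6 = 0 ∧
      -M 2 1 - M 3 4 - M 5 6 = 0 ∧
      M 0 0 + M 1 1 + M 4 4 + M 5 5 = -(-4 * h) ∧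
      M 0 0 + M 1 1 + M 3 3 + M 6 6 = -(-4 * h) ∧
      M 2 1 - M 4 3 - M 6 5 = 0 ∧
      -M 2 0 - M 5 3 + M 6 4 = 0 ∧
      -M 3 2 + M 4 1 - M 5 0 = 0 ∧
      M 3 1 + M 4 2 - M 6 0 = 0 ∧
      -M 3 0 + M 5 2 - M 6 1 = 0 ∧
      -M 4 0 - M 5 1 - M 6 2 = 0) ↔
    symPart M = h • (1 : Matrix (Fin 7) (Fin 7) ℝ) ∧ g2Part M = 0 := by
  have hsym : symPart M = h • (1 : Matrix (Fin 7) (Fin 7) ℝ) ↔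
      ∀ i j, M i j + M j i = if i = j then 2 * h else 0 := by
    rw [← Matrix.ext_iff]
    refine forall_congr' fun i => forall_congr' fun j => ?_
    by_cases hij : i = j
    · simp only [symPart, hij, Matrix.smul_apply, Matrix.add_apply, Matrix.transpose_apply,
        Matrix.one_apply_eq, smul_eq_mul, if_true]
      constructor <;> intro h' <;> linarith
    · simp only [symPart, Matrix.smul_apply, Matrix.add_apply, Matrix.transpose_apply,
        Matrix.one_apply_ne hij, smul_eq_mul, if_neg hij]
      constructor <;> intro h' <;> linarith
  have hg : g2Part M = 0 ↔ ∀ i, g2Part M i = 0 := funext_iff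
  rw [hsym, hg]
  constructor
  · rintro ⟨t123, t124, t125, t126, t127, t134, t135, t136, t137, t145, t146, t147, t156, t157,
      t167, t234, t235, t236, t237, t245, t246, t247, t256, t257, t267, t345, t346, t347, t356,
      t357, t367, t456, t457, t467, t567⟩
    constructor
    · have key : ∀ i j, i ≤ j → M i j + M j i = if i = j then 2 * h else 0 := by
        intro i j hij
        fin_cases i <;> fin_cases j <;>
          first
          | exact absurd hij (by decide)
          | (simp; linarith)
      intro i j
      rcases le_total i j with hij | hij
      · exact key i j hij
      · rw [add_comm, key j i hij]
        simp only [eq_comm]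
    · intro i
      fin_cases i <;> simp [g2Part] <;> linarith
  · rintro ⟨hs, hr⟩
    have s00 := hs 0 0
    have s01 := hs 0 1
    have s02 := hs 0 2
    have s03 := hs 0 3
    have s04 := hs 0 4
    have s05 := hs 0 5
    have s06 := hs 0 6
    have s11 := hs 1 1
    have s12 := hs 1 2
    have s13 := hs 1 3
    have s14 := hs 1 4
    have s15 := hs 1 5
    have s16 := hs 1 6
    have s22 := hs 2 2
    have s23 := hs 2 3
    have s24 := hs 2 4
    have s25 := hs 2 5
    have s26 := hs 2 6
    have s33 := hs 3 3
    have s34 := hs 3 4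
    have s35 := hs 3 5
    have s36 := hs 3 6
    have s44 := hs 4 4
    have s45 := hs 4 5
    have s46 := hs 4 6
    have s55 := hs 5 5
    have s56 := hs 5 6
    have s66 := hs 6 6
    have r0 := hr 0
    have r1 := hr 1
    have r2 := hr 2
    have r3 := hr 3
    have r4 := hr 4
    have r5 := hr 5
    have r6 := hr 6
    simp only [g2Part, Matrix.cons_val] at r0 r1 r2 r3 r4 r5 r6
    simp at s00 s01 s02 s03 s04 s05 s06 s11 s12 s13 s14 s15 s16 s22
    simp at s23 s24 s25 s26 s33 s34 s35 s36 s44 s45 s46 s55 s56 s66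
    refine ⟨?_, ?_, ?_, ?_, ?_, ?_, ?_, ?_, ?_, ?_, ?_, ?_, ?_, ?_, ?_, ?_, ?_, ?_, ?_, ?_,
        ?_, ?_, ?_, ?_, ?_, ?_, ?_, ?_, ?_, ?_, ?_, ?_, ?_, ?_, ?_⟩ <;> linarith

end QuasiAbelian

/-! ### Three-forms on increasing triples -/

namespace InvForm

variable {V : Type*} [NormedAddCommGroup V] [InnerProductSpace ℝ V]

theorem ext_orderEmbedding {n k : ℕ} (b : OrthonormalBasis (Fin n) ℝ V)
    {α β : V [⋀^Fin k]→ₗ[ℝ] ℝ} (h : ∀ I : Fin k ↪o Fin n, α (b ∘ I) = β (b ∘ I)) : α = β := by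
  refine b.toBasis.ext_alternating fun v hv => ?_
  have hm : StrictMono (v ∘ Tuple.sort v) :=
    (Tuple.monotone_sort v).strictMono_of_injective (hv.comp (Tuple.sort v).injective)
  have h' := h (OrderEmbedding.ofStrictMono _ hm)
  rw [OrderEmbedding.coe_ofStrictMono, ← Function.comp_assoc, AlternatingMap.map_perm,
    AlternatingMap.map_perm] at h'
  simp only [OrthonormalBasis.coe_toBasis]
  rcases Int.units_eq_one_or (Equiv.Perm.sign (Tuple.sort v)) with hs | hs
  · rw [hs, one_smul, one_smul] at h'
    exact h'
  · rw [hs] at h'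
    simpa [Units.smul_def, Function.comp_def] using h'

theorem mem_increasing_triples {i j k : Fin 8} (h0 : i ≠ 0) (h1 : i < j) (h2 : j < k) :
    (i, j, k) ∈ [(1, 2, 3), (1, 2, 4), (1, 2, 5), (1, 2, 6), (1, 2, 7), (1, 3, 4), (1, 3, 5), (1, 3, 6), (1, 3, 7), 
      (1, 4, 5), (1, 4, 6), (1, 4, 7), (1, 5, 6), (1, 5, 7), (1, 6, 7), 
      (2, 3, 4), (2, 3, 5), (2, 3, 6), (2, 3, 7), (2, 4, 5), (2, 4, 6), (2, 4, 7), (2, 5, 6), (2, 5, 7), (2, 6, 7), (3, 4, 5), (3, 4, 6), (3, 4, 7), 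
      (3, 5, 6), (3, 5, 7), (3, 6, 7), (4, 5, 6), (4, 5, 7), (4, 6, 7), (5, 6, 7)] := by
  revert i j k
  decide

/-- Two 3-forms agree if they agree on the increasing triples of basis vectors. -/
theorem ext_three (b : OrthonormalBasis (Fin 8) ℝ V) {α β : V [⋀^Fin 3]→ₗ[ℝ] ℝ}
    (h0 : ∀ j k, 0 < j → j < k → α ![b 0, b j, b k] = β ![b 0, b j, b k])
    (h : ∀ i j k, i ≠ 0 → i < j → j < k → α ![b i, b j, b k] = β ![b i, b j, b k]) : α = β := by
  refine ext_orderEmbedding b fun I => ?_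
  have e : b ∘ I = ![b (I 0), b (I 1), b (I 2)] := by
    ext i; fin_cases i <;> rfl
  have h1 : I 0 < I 1 := I.strictMono (by decide)
  have h2 : I 1 < I 2 := I.strictMono (by decide)
  rw [e]
  by_cases hi : I 0 = 0
  · rw [hi] at h1 ⊢
    exact h0 _ _ h1 h2
  · exact h _ _ _ hi h1 h2

theorem sum_orderEmbedding_three (F : Fin 8 → Fin 8 → Fin 8 → ℝ) (h0 : ∀ j k, F 0 j k = 0) :
    ∑ I : Fin 3 ↪o Fin 8, F (I 0) (I 1) (I 2) =
      F 1 2 3 + F 1 2 4 + F 1 2 5 + F 1 2 6 + F 1 2 7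
      + F 1 3 4 + F 1 3 5 + F 1 3 6 + F 1 3 7 + F 1 4 5
      + F 1 4 6 + F 1 4 7 + F 1 5 6 + F 1 5 7 + F 1 6 7
      + F 2 3 4 + F 2 3 5 + F 2 3 6 + F 2 3 7 + F 2 4 5
      + F 2 4 6 + F 2 4 7 + F 2 5 6 + F 2 5 7 + F 2 6 7
      + F 3 4 5 + F 3 4 6 + F 3 4 7 + F 3 5 6 + F 3 5 7
      + F 3 6 7 + F 4 5 6 + F 4 5 7 + F 4 6 7 + F 5 6 7 := by
  have h : ∑ I : Fin 3 ↪o Fin 8, F (I 0) (I 1) (I 2) =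
      ∑ i, ∑ j, ∑ k, if i < j ∧ j < k then F i j k else 0 := by
    simp_rw [← Fintype.sum_prod_type']
    rw [← Finset.sum_filter]
    refine Finset.sum_bij (fun I _ => (I 0, I 1, I 2)) ?_ ?_ ?_ ?_
    · intro I _
      simp
    · intro I _ J _ hIJ
      simp only [Prod.mk.injEq] at hIJ
      ext a
      fin_cases a
      exacts [congrArg Fin.val hIJ.1, congrArg Fin.val hIJ.2.1, congrArg Fin.val hIJ.2.2]
    · rintro ⟨i, j, k⟩ hx
      have hx' : i < j ∧ j < k := by simpa using hx
      have hm : StrictMono ![i, j, k] := by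
        rw [Fin.strictMono_iff_lt_succ]
        intro a
        fin_cases a
        exacts [hx'.1, hx'.2]
      exact ⟨OrderEmbedding.ofStrictMono _ hm, Finset.mem_univ _, rfl⟩
    · intro I _
      rfl
  rw [h]
  simp [Fin.sum_univ_eight, h0]
  ring

end InvForm

/-! ### Torsion types in an adapted Cayley frame -/

namespace QuasiAbelian

open InvForm

variable {E : Matrix (Fin 7) (Fin 7) ℝ} {b : OrthonormalBasis (Fin 8) ℝ (QuasiAbelian E)}

/-- The matrix of `ad(b₀)` on the span of `b₁, …, b₇`. -/
noncomputable def adMatrix (b : OrthonormalBasis (Fin 8) ℝ (QuasiAbelian E)) :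
    Matrix (Fin 7) (Fin 7) ℝ :=
  Matrix.of fun p i => adEntry b p.succ i.succ

/-- This covers the parallel case (`v = 0`) and the locally conformally parallel one together. Since
`⋆dΩ` vanishes on triples containing `b 0`, so does `i(v)Ω`, which makes `v` a multiple of `b 0`.
The factor `-4` normalizes the symmetric part to `h` times the identity. -/
theorem starD_eq_curryLeft_iff (hb : IsAdapted b) (v : QuasiAbelian E) (h : ℝ)
    (hv : ⟪b 0, v⟫_ℝ = -4 * h) :
    starD (cayleyForm b) = (cayleyForm b).curryLeft v ↔ (∀ p ≠ 0, ⟪b p, v⟫_ℝ = 0) ∧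
      symPart (adMatrix b) = h • (1 : Matrix (Fin 7) (Fin 7) ℝ) ∧ g2Part (adMatrix b) = 0 := by
  rw [← torsion_linear_system]
  obtain ⟨t123, t124, t125, t126, t127, t134, t135, t136, t137, t145, t146, t147, t156, t157,
      t167, t234, t235, t236, t237, t245, t246, t247, t256, t257, t267, t345, t346, t347, t356,
      t357, t367, t456, t457, t467, t567⟩ :=
    starD_components hb
  obtain ⟨c123, c124, c125, c126, c127, c134, c135, c136, c137, c145, c146, c147, c156, c157,
      c167, c234, c235, c236, c237, c245, c246, c247, c256, c257, c267, c345, c346, c347, c356,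
      c357, c367, c456, c457, c467, c567⟩ :=
    cayleyForm_components b v
  rw [hv] at c123 c145 c167 c246 c257 c347 c356
  constructor
  · intro hΩ
    have e : ∀ x, starD (cayleyForm b) x = cayleyForm b (Matrix.vecCons v x) := fun x => by
      rw [hΩ, AlternatingMap.curryLeft_apply_apply]
    have hp : ∀ p ≠ 0, ⟪b p, v⟫_ℝ = 0 := by
      obtain ⟨z1, z2, z3, z4, z5, z6, z7⟩ := cayleyForm_components_zero b v
      have z : ∀ j k, cayleyForm b ![v, b 0, b j, b k] = 0 := fun j k => by
        rw [← e, starD_frame_zero hb]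
      rw [z] at z1 z2 z3 z4 z5 z6 z7
      intro p hp
      fin_cases p
      · exact absurd rfl hp
      · exact neg_eq_zero.mp z1.symm
      · exact z2.symm
      · exact neg_eq_zero.mp z3.symm
      · exact neg_eq_zero.mp z4.symm
      · exact z5.symm
      · exact neg_eq_zero.mp z6.symm
      · exact z7.symm
    refine ⟨hp, (t123.symm.trans (e _)).trans c123,
      (t124.symm.trans (e _)).trans (c124.trans (by simp [hp])),
      (t125.symm.trans (e _)).trans (c125.trans (by simp [hp])),
      (t126.symm.trans (e _)).trans (c126.trans (by simp [hp])),
      (t127.symm.trans (e _)).trans (c127.trans (by simp [hp])),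
      (t134.symm.trans (e _)).trans (c134.trans (by simp [hp])),
      (t135.symm.trans (e _)).trans (c135.trans (by simp [hp])),
      (t136.symm.trans (e _)).trans (c136.trans (by simp [hp])),
      (t137.symm.trans (e _)).trans (c137.trans (by simp [hp])),
      (t145.symm.trans (e _)).trans c145,
      (t146.symm.trans (e _)).trans (c146.trans (by simp [hp])),
      (t147.symm.trans (e _)).trans (c147.trans (by simp [hp])),
      (t156.symm.trans (e _)).trans (c156.trans (by simp [hp])),
      (t157.symm.trans (e _)).trans (c157.trans (by simp [hp])),
      (t167.symm.trans (e _)).trans c167,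
      (t234.symm.trans (e _)).trans (c234.trans (by simp [hp])),
      (t235.symm.trans (e _)).trans (c235.trans (by simp [hp])),
      (t236.symm.trans (e _)).trans (c236.trans (by simp [hp])),
      (t237.symm.trans (e _)).trans (c237.trans (by simp [hp])),
      (t245.symm.trans (e _)).trans (c245.trans (by simp [hp])),
      (t246.symm.trans (e _)).trans c246,
      (t247.symm.trans (e _)).trans (c247.trans (by simp [hp])),
      (t256.symm.trans (e _)).trans (c256.trans (by simp [hp])),
      (t257.symm.trans (e _)).trans c257,
      (t267.symm.trans (e _)).trans (c267.trans (by simp [hp])),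
      (t345.symm.trans (e _)).trans (c345.trans (by simp [hp])),
      (t346.symm.trans (e _)).trans (c346.trans (by simp [hp])),
      (t347.symm.trans (e _)).trans c347,
      (t356.symm.trans (e _)).trans c356,
      (t357.symm.trans (e _)).trans (c357.trans (by simp [hp])),
      (t367.symm.trans (e _)).trans (c367.trans (by simp [hp])),
      (t456.symm.trans (e _)).trans (c456.trans (by simp [hp])),
      (t457.symm.trans (e _)).trans (c457.trans (by simp [hp])),
      (t467.symm.trans (e _)).trans (c467.trans (by simp [hp])),
      (t567.symm.trans (e _)).trans (c567.trans (by simp [hp]))⟩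
  · rintro ⟨hp, e123, e124, e125, e126, e127, e134, e135, e136, e137, e145, e146, e147, e156,
      e157, e167, e234, e235, e236, e237, e245, e246, e247, e256, e257, e267, e345, e346, e347,
      e356, e357, e367, e456, e457, e467, e567⟩
    refine ext_three b (fun j k hj hjk => ?_) fun i j k hi hij hjk => ?_
    · rw [starD_frame_zero hb, AlternatingMap.curryLeft_apply_apply]
      have hv0 : v = (-4 * h) • b 0 := by
        conv_lhs => rw [← b.sum_repr' v]
        rw [Finset.sum_eq_single 0 (fun k _ hk => by rw [hp k hk, zero_smul]) (by simp), hv]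
      have h0 : (cayleyForm b).curryLeft (b 0) ![b 0, b j, b k] = 0 :=
        AlternatingMap.map_eq_zero_of_eq (cayleyForm b) (Matrix.vecCons (b 0) ![b 0, b j, b k])
          (i := 0) (j := 1) rfl (by decide)
      rw [← AlternatingMap.curryLeft_apply_apply, hv0, map_smul, AlternatingMap.smul_apply, h0,
        smul_zero]
    · rw [AlternatingMap.curryLeft_apply_apply]
      have hmem := mem_increasing_triples hi hij hjk
      simp only [List.mem_cons, Prod.mk.injEq, List.not_mem_nil, or_false] at hmem
      rcases hmem with ⟨rfl, rfl, rfl⟩ | ⟨rfl, rfl, rfl⟩ | ⟨rfl, rfl, rfl⟩ | ⟨rfl, rfl, rfl⟩ | ⟨rfl, rfl, rfl⟩ | ⟨rfl, rfl, rfl⟩ | ⟨rfl, rfl, rfl⟩ | ⟨rfl, rfl, rfl⟩ | ⟨rfl, rfl, rfl⟩ | ⟨rfl, rfl, rfl⟩ | ⟨rfl, rfl, rfl⟩ | ⟨rfl, rfl, rfl⟩ | ⟨rfl, rfl, rfl⟩ | ⟨rfl, rfl, rfl⟩ | ⟨rfl, rfl, rfl⟩ | ⟨rfl, rfl, rfl⟩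 | ⟨rfl, rfl, rfl⟩ | ⟨rfl, rfl, rfl⟩ | ⟨rfl, rfl, rfl⟩ | ⟨rfl, rfl, rfl⟩ | ⟨rfl, rfl, rfl⟩ | ⟨rfl, rfl, rfl⟩ | ⟨rfl, rfl, rfl⟩ | ⟨rfl, rfl, rfl⟩ | ⟨rfl, rfl, rfl⟩ | ⟨rfl, rfl, rfl⟩ | ⟨rfl, rfl, rfl⟩ | ⟨rfl, rfl, rfl⟩ | ⟨rfl, rfl, rfl⟩ | ⟨rfl, rfl, rfl⟩ | ⟨rfl, rfl, rfl⟩ | ⟨rfl, rfl, rfl⟩ | ⟨rfl, rfl, rfl⟩ | ⟨rfl, rfl, rfl⟩ | ⟨rfl, rfl, rfl⟩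
      · exact (t123.trans e123).trans c123.symm
      · exact (t124.trans e124).trans (c124.trans (by simp [hp])).symm
      · exact (t125.trans e125).trans (c125.trans (by simp [hp])).symm
      · exact (t126.trans e126).trans (c126.trans (by simp [hp])).symm
      · exact (t127.trans e127).trans (c127.trans (by simp [hp])).symm
      · exact (t134.trans e134).trans (c134.trans (by simp [hp])).symm
      · exact (t135.trans e135).trans (c135.trans (by simp [hp])).symm
      · exact (t136.trans e136).trans (c136.trans (by simp [hp])).symm
      · exact (t137.trans e137).trans (c137.trans (by simp [hp])).symm
      · exact (t145.trans e145).trans c145.symm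
      · exact (t146.trans e146).trans (c146.trans (by simp [hp])).symm
      · exact (t147.trans e147).trans (c147.trans (by simp [hp])).symm
      · exact (t156.trans e156).trans (c156.trans (by simp [hp])).symm
      · exact (t157.trans e157).trans (c157.trans (by simp [hp])).symm
      · exact (t167.trans e167).trans c167.symm
      · exact (t234.trans e234).trans (c234.trans (by simp [hp])).symm
      · exact (t235.trans e235).trans (c235.trans (by simp [hp])).symm
      · exact (t236.trans e236).trans (c236.trans (by simp [hp])).symm
      · exact (t237.trans e237).trans (c237.trans (by simp [hp])).symm
      · exact (t245.trans e245).trans (c245.trans (by simp [hp])).symm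
      · exact (t246.trans e246).trans c246.symm
      · exact (t247.trans e247).trans (c247.trans (by simp [hp])).symm
      · exact (t256.trans e256).trans (c256.trans (by simp [hp])).symm
      · exact (t257.trans e257).trans c257.symm
      · exact (t267.trans e267).trans (c267.trans (by simp [hp])).symm
      · exact (t345.trans e345).trans (c345.trans (by simp [hp])).symm
      · exact (t346.trans e346).trans (c346.trans (by simp [hp])).symm
      · exact (t347.trans e347).trans c347.symm
      · exact (t356.trans e356).trans c356.symm
      · exact (t357.trans e357).trans (c357.trans (by simp [hp])).symm
      · exact (t367.trans e367).trans (c367.trans (by simp [hp])).symm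
      · exact (t456.trans e456).trans (c456.trans (by simp [hp])).symm
      · exact (t457.trans e457).trans (c457.trans (by simp [hp])).symm
      · exact (t467.trans e467).trans (c467.trans (by simp [hp])).symm
      · exact (t567.trans e567).trans (c567.trans (by simp [hp])).symm

theorem isParallel_cayleyForm_iff (hb : IsAdapted b) :
    IsParallel (cayleyForm b) ↔ symPart (adMatrix b) = 0 ∧ g2Part (adMatrix b) = 0 := by
  have h := starD_eq_curryLeft_iff hb 0 0 (by simp)
  rw [map_zero, zero_smul] at h
  rw [IsParallel, h]
  simp

theorem isLocConfParallel_cayleyForm_iff (hb : IsAdapted b) :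
    IsLocConfParallel (cayleyForm b) ↔
      (∃ h : ℝ, symPart (adMatrix b) = h • (1 : Matrix (Fin 7) (Fin 7) ℝ)) ∧
        g2Part (adMatrix b) = 0 := by
  constructor
  · rintro ⟨v, hv⟩
    have h := (starD_eq_curryLeft_iff hb v (-⟪b 0, v⟫_ℝ / 4) (by ring)).mp hv
    exact ⟨⟨_, h.2.1⟩, h.2.2⟩
  · rintro ⟨⟨h, hs⟩, hg⟩
    refine ⟨(-4 * h) • b 0, (starD_eq_curryLeft_iff hb _ h ?_).mpr ⟨fun p hp => ?_, hs, hg⟩⟩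
    · rw [inner_smul_right, b.inner_eq_ite, if_pos rfl, mul_one]
    · rw [inner_smul_right, b.inner_eq_ite, if_neg hp, mul_zero]

/-- The projection to `Λ³₈` retains only the trace and the `Λ²₇` part. The factor 4 arises because
each diagonal entry occurs in four of the seven components that pair with `b 0`. The traceless
symmetric part contributes to `Λ³₄₈` only. -/
theorem formInner_starD (hb : IsAdapted b) (v : QuasiAbelian E) :
    formInner (stdBasis E) (starD (cayleyForm b)) ((cayleyForm b).curryLeft v) =
      -4 * (adMatrix b).trace * ⟪b 0, v⟫_ℝ +
        2 * ∑ p, g2Part (adMatrix b) p * ⟪b p.succ, v⟫_ℝ := by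
  obtain ⟨t123, t124, t125, t126, t127, t134, t135, t136, t137, t145, t146, t147, t156, t157,
      t167, t234, t235, t236, t237, t245, t246, t247, t256, t257, t267, t345, t346, t347, t356,
      t357, t367, t456, t457, t467, t567⟩ :=
    starD_components hb
  obtain ⟨c123, c124, c125, c126, c127, c134, c135, c136, c137, c145, c146, c147, c156, c157,
      c167, c234, c235, c236, c237, c245, c246, c247, c256, c257, c267, c345, c346, c347, c356,
      c357, c367, c456, c457, c467, c567⟩ :=
    cayleyForm_components b v
  have e : formInner (stdBasis E) (starD (cayleyForm b)) ((cayleyForm b).curryLeft v) =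
      ∑ I : Fin 3 ↪o Fin 8, starD (cayleyForm b) ![b (I 0), b (I 1), b (I 2)] *
        cayleyForm b ![v, b (I 0), b (I 1), b (I 2)] := by
    rw [formInner_eq _ b, formInner]
    refine Finset.sum_congr rfl fun I _ => ?_
    have e : (fun a => b (I a)) = ![b (I 0), b (I 1), b (I 2)] := by
      ext i; fin_cases i <;> rfl
    rw [e, AlternatingMap.curryLeft_apply_apply]
  rw [e, sum_orderEmbedding_three (fun i j k => starD (cayleyForm b) ![b i, b j, b k] *
    cayleyForm b ![v, b i, b j, b k]) fun j k => by rw [starD_frame_zero hb, zero_mul]]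
  simp only [t123, t124, t125, t126, t127, t134, t135, t136, t137, t145, t146, t147, t156, t157,
      t167, t234, t235, t236, t237, t245, t246, t247, t256, t257, t267, t345, t346, t347, t356,
      t357, t367, t456, t457, t467, t567, c123, c124, c125, c126, c127, c134, c135, c136, c137,
      c145, c146, c147, c156, c157, c167, c234, c235, c236, c237, c245, c246, c247, c256, c257,
      c267, c345, c346, c347, c356, c357, c367, c456, c457, c467, c567]
  rw [Matrix.trace, Fin.sum_univ_seven, Fin.sum_univ_seven]
  simp only [g2Part, adMatrix, Matrix.of_apply, Matrix.diag_apply, Matrix.cons_val]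
  simp only [Fin.reduceSucc]
  ring

theorem isBalanced_cayleyForm_iff (hb : IsAdapted b) :
    IsBalanced (cayleyForm b) ↔ (adMatrix b).trace = 0 ∧ g2Part (adMatrix b) = 0 := by
  have h : IsBalanced (cayleyForm b) ↔ ∀ v : QuasiAbelian E,
      -4 * (adMatrix b).trace * ⟪b 0, v⟫_ℝ +
        2 * ∑ p, g2Part (adMatrix b) p * ⟪b p.succ, v⟫_ℝ = 0 := by
    simp_rw [← formInner_starD hb]
    exact ⟨fun h v => h _ ⟨v, rfl⟩, fun h γ ⟨v, hv⟩ => hv ▸ h v⟩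
  rw [h]
  constructor
  · intro h'
    constructor
    · have := h' (b 0)
      simpa [b.inner_eq_ite] using this
    · ext p
      have := h' (b p.succ)
      simpa [b.inner_eq_ite, (Fin.succ_ne_zero p).symm] using this
  · rintro ⟨h1, h2⟩ v
    simp [h1, h2]

end QuasiAbelian

/-! ### Adapted frames and rotations of `ℝ⁷` -/

namespace QuasiAbelian

open InvForm Matrix

variable {E : Matrix (Fin 7) (Fin 7) ℝ}

/-- The vectors `e₀, R e₁, …, R e₇`. -/
def frameVec (E R : Matrix (Fin 7) (Fin 7) ℝ) : Fin 8 → QuasiAbelian E :=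
  Fin.cons (mk 1 0) fun j => mk 0 (Rᵀ j)

theorem det_stdBasis_frameVec (R : Matrix (Fin 7) (Fin 7) ℝ) :
    (stdBasis E).toBasis.det (frameVec E R) = R.det := by
  have h : (stdBasis E).toBasis.toMatrix (frameVec E R) =
      Matrix.of fun i j : Fin 8 => WithLp.ofLp (frameVec E R j) i := by
    ext i j
    rfl
  rw [Module.Basis.det_apply, h, det_succ_column_zero, Fin.sum_univ_succ]
  have h0 : (Matrix.of fun i j : Fin 8 => WithLp.ofLp (frameVec E R j) i) 0 0 = 1 := rfl
  have hs : ∀ i : Fin 7,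
      (Matrix.of fun i j : Fin 8 => WithLp.ofLp (frameVec E R j) i) i.succ 0 = 0 := fun _ => rfl
  have hR : (Matrix.of fun i j : Fin 8 => WithLp.ofLp (frameVec E R j) i).submatrix
      (Fin.succAbove 0) Fin.succ = R := by
    ext i j
    rfl
  simp only [h0, hs, hR, mul_zero, zero_mul, Finset.sum_const_zero, add_zero]
  simp

theorem orthonormal_frameVec {R : Matrix (Fin 7) (Fin 7) ℝ} (hR : Rᵀ * R = 1) :
    Orthonormal ℝ (frameVec E R) := by
  rw [orthonormal_iff_ite]
  intro i j
  refine Fin.cases ?_ (fun i => ?_) i <;> refine Fin.cases ?_ (fun j => ?_) j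
  · rw [frameVec, Fin.cons_zero, inner_eq]
    simp [fst_mk, snd_mk]
  · simp [frameVec, inner_eq, fst_mk, snd_mk, (Fin.succ_ne_zero _).symm]
  · simp [frameVec, inner_eq, fst_mk, snd_mk]
  · have := congrFun (congrFun hR i) j
    rw [Matrix.mul_apply, Matrix.one_apply] at this
    simpa [frameVec, inner_eq, fst_mk, snd_mk, dotProduct] using this

theorem exists_frame {R : Matrix (Fin 7) (Fin 7) ℝ} (hR : R ∈ specialOrthogonalGroup (Fin 7) ℝ) :
    ∃ b : OrthonormalBasis (Fin 8) ℝ (QuasiAbelian E), IsAdapted b ∧ ⇑b = frameVec E R := by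
  obtain ⟨hO, hdet⟩ := mem_specialOrthogonalGroup_iff.mp hR
  have ho : Orthonormal ℝ (frameVec E R) :=
    orthonormal_frameVec (mem_orthogonalGroup_iff' (Fin 7) ℝ |>.mp hO)
  have : FiniteDimensional ℝ (QuasiAbelian E) :=
    (stdBasis E).toBasis.finiteDimensional_of_finite
  have hspan : ⊤ ≤ Submodule.span ℝ (Set.range (frameVec E R)) := by
    rw [ho.linearIndependent.span_eq_top_of_card_eq_finrank'
      (by rw [Module.finrank_eq_card_basis (stdBasis E).toBasis])]
  refine ⟨OrthonormalBasis.mk ho hspan, ⟨?_, ?_⟩, OrthonormalBasis.coe_mk ho hspan⟩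
  · rw [OrthonormalBasis.coe_mk, stdBasis_zero]
    rfl
  · rw [eq_comm, Module.Basis.orientation_eq_iff_det_pos, OrthonormalBasis.coe_toBasis,
      OrthonormalBasis.coe_mk, det_stdBasis_frameVec, hdet]
    exact one_pos

theorem IsAdapted.exists_eq_frameVec {b : OrthonormalBasis (Fin 8) ℝ (QuasiAbelian E)}
    (hb : IsAdapted b) : ∃ R ∈ specialOrthogonalGroup (Fin 7) ℝ, ⇑b = frameVec E R := by
  have e : ⇑b = frameVec E (Matrix.of fun i j => (b j.succ).snd i) := by
    ext i
    refine Fin.cases ?_ (fun i => ?_) i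
    · rw [hb.zero, stdBasis_zero]
      rfl
    · rw [ext_iff']
      exact ⟨hb.fst_eq_zero (Fin.succ_ne_zero i), rfl⟩
  refine ⟨Matrix.of fun i j => (b j.succ).snd i, mem_specialOrthogonalGroup_iff.mpr ⟨?_, ?_⟩, e⟩
  · rw [mem_orthogonalGroup_iff']
    ext i j
    have h := orthonormal_iff_ite.mp b.orthonormal i.succ j.succ
    rw [inner_eq, hb.fst_eq_zero (Fin.succ_ne_zero i), zero_mul, zero_add] at h
    rw [Matrix.one_apply]
    simpa [Matrix.mul_apply, dotProduct] using h
  · rw [← det_stdBasis_frameVec (E := E), ← e,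
      OrthonormalBasis.same_orientation_iff_det_eq_det.mpr hb.orientation.symm,
      ← OrthonormalBasis.coe_toBasis, Module.Basis.det_self]

theorem adMatrix_eq {b : OrthonormalBasis (Fin 8) ℝ (QuasiAbelian E)}
    {R : Matrix (Fin 7) (Fin 7) ℝ} (hb : ⇑b = frameVec E R) : adMatrix b = Rᵀ * E * R := by
  ext p i
  have h0 : b 0 = mk 1 0 := by rw [hb]; rfl
  have hs : ∀ i : Fin 7, b i.succ = mk 0 (Rᵀ i) := fun i => by rw [hb]; rfl
  rw [adMatrix, Matrix.of_apply, adEntry, inner_eq, fst_bracket, snd_bracket, h0, hs, hs]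
  simp only [fst_mk, snd_mk, mul_zero, zero_smul, one_smul, sub_zero, zero_add]
  rw [Matrix.mul_assoc, Matrix.mul_apply]
  rfl

/-- Invariant `Spin(7)` structures are parametrized by the rotations of `ℝ⁷`. -/
theorem exists_isSpin7_iff (Q : (QuasiAbelian E [⋀^Fin 4]→ₗ[ℝ] ℝ) → Prop)
    (T : Matrix (Fin 7) (Fin 7) ℝ → Prop)
    (hQ : ∀ b : OrthonormalBasis (Fin 8) ℝ (QuasiAbelian E), IsAdapted b →
      (Q (cayleyForm b) ↔ T (adMatrix b))) :
    (∃ Ω, IsSpin7 Ω ∧ Q Ω) ↔ ∃ R ∈ specialOrthogonalGroup (Fin 7) ℝ, T (Rᵀ * E * R) := by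
  constructor
  · rintro ⟨_, ⟨b, ho, rfl⟩, h⟩
    -- Transitivity on unit vectors replaces the given Cayley frame by one of the same form that
    -- starts with `e₀`.
    obtain ⟨b', ho', hc, h0⟩ :=
      exists_cayleyFrame b (stdBasis E 0) ((stdBasis E).norm_eq_one 0)
    have hb' : IsAdapted b' := ⟨h0, ho'.trans ho⟩
    obtain ⟨R, hR, e⟩ := hb'.exists_eq_frameVec
    refine ⟨R, hR, ?_⟩
    rw [← adMatrix_eq e, ← hQ b' hb', hc]
    exact h
  · rintro ⟨R, hR, h⟩
    obtain ⟨b, hb, e⟩ := exists_frame (E := E) hR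
    refine ⟨cayleyForm b, ⟨b, hb.orientation, rfl⟩, ?_⟩
    rw [hQ b hb, adMatrix_eq e]
    exact h

theorem g2Part_skewPart (M : Matrix (Fin 7) (Fin 7) ℝ) : g2Part (skewPart M) = g2Part M := by
  ext i
  fin_cases i <;> simp [g2Part, skewPart] <;> ring

theorem skewPart_conj (R : Matrix (Fin 7) (Fin 7) ℝ) :
    skewPart (Rᵀ * E * R) = Rᵀ * skewPart E * R := by
  simp only [skewPart, transpose_mul, transpose_transpose, Matrix.mul_smul, Matrix.smul_mul,
    Matrix.mul_sub, Matrix.sub_mul, Matrix.mul_assoc]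

theorem symPart_conj (R : Matrix (Fin 7) (Fin 7) ℝ) :
    symPart (Rᵀ * E * R) = Rᵀ * symPart E * R := by
  simp only [symPart, transpose_mul, transpose_transpose, Matrix.mul_smul, Matrix.smul_mul,
    Matrix.mul_add, Matrix.add_mul, Matrix.mul_assoc]

theorem g2Part_conj (R : Matrix (Fin 7) (Fin 7) ℝ) :
    g2Part (Rᵀ * E * R) = g2Part (Rᵀ * skewPart E * R) := by
  rw [← g2Part_skewPart, skewPart_conj]

/-- Scalar matrices are fixed by conjugation, so the condition on the symmetric part puts no
constraint on the rotation. -/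
theorem symPart_conj_eq_smul_iff {R : Matrix (Fin 7) (Fin 7) ℝ}
    (hR : R ∈ specialOrthogonalGroup (Fin 7) ℝ) (h : ℝ) :
    symPart (Rᵀ * E * R) = h • (1 : Matrix (Fin 7) (Fin 7) ℝ) ↔
      symPart E = h • (1 : Matrix (Fin 7) (Fin 7) ℝ) := by
  have hO := (mem_specialOrthogonalGroup_iff.mp hR).1
  have h1 : Rᵀ * R = 1 := (mem_orthogonalGroup_iff' (Fin 7) ℝ).mp hO
  have h2 : R * Rᵀ = 1 := (mem_orthogonalGroup_iff (Fin 7) ℝ).mp hO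
  rw [symPart_conj]
  constructor
  · intro e
    calc symPart E = (R * Rᵀ) * symPart E * (R * Rᵀ) := by rw [h2, one_mul, mul_one]
      _ = R * (Rᵀ * symPart E * R) * Rᵀ := by simp only [Matrix.mul_assoc]
      _ = _ := by rw [e, Matrix.mul_smul, Matrix.smul_mul, mul_one, h2]
  · intro e
    rw [e, Matrix.mul_smul, Matrix.smul_mul, mul_one, h1]

theorem trace_conj {R : Matrix (Fin 7) (Fin 7) ℝ} (hR : R ∈ specialOrthogonalGroup (Fin 7) ℝ) :
    (Rᵀ * E * R).trace = E.trace := by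
  have h2 : R * Rᵀ = 1 :=
    (mem_orthogonalGroup_iff (Fin 7) ℝ).mp (mem_specialOrthogonalGroup_iff.mp hR).1
  rw [Matrix.trace_mul_comm, ← Matrix.mul_assoc, h2, one_mul]

end QuasiAbelian

/-! ### The normal form of a skew-symmetric endomorphism -/

section SkewMap

variable {V : Type*} [NormedAddCommGroup V] [InnerProductSpace ℝ V] [FiniteDimensional ℝ V]

/-- A skew-symmetric endomorphism rotates some plane of every invariant subspace of dimension at
least two. -/
theorem exists_invariant_plane (T : V →ₗ[ℝ] V) (hT : ∀ x y, ⟪T x, y⟫_ℝ = -⟪x, T y⟫_ℝ)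
    (W : Submodule ℝ V) (hW : ∀ x ∈ W, T x ∈ W) (hd : 2 ≤ Module.finrank ℝ W) :
    ∃ (l : ℝ) (v w : V), 0 ≤ l ∧ v ∈ W ∧ w ∈ W ∧ ‖v‖ = 1 ∧ ‖w‖ = 1 ∧ ⟪v, w⟫_ℝ = 0 ∧
      T v = l • w ∧ T w = -l • v := by
  by_cases h0 : ∀ x ∈ W, T x = 0
  · let b := stdOrthonormalBasis ℝ W
    let i : Fin (Module.finrank ℝ W) := ⟨0, by omega⟩
    let j : Fin (Module.finrank ℝ W) := ⟨1, by omega⟩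
    refine ⟨0, b i, b j, le_rfl, (b i).2, (b j).2, b.norm_eq_one i, b.norm_eq_one j, ?_, ?_, ?_⟩
    · have h := b.inner_eq_ite i j
      rwa [if_neg (by simp [i, j])] at h
    · rw [h0 _ (b i).2, zero_smul]
    · rw [h0 _ (b j).2, neg_zero, zero_smul]
  -- The square of `T` is symmetric on `W`. A unit eigenvector `v` with eigenvalue `μ ≠ 0` satisfies
  -- `‖T v‖² = -μ`, and `v` and the normalized `T v` span the plane.
  · have hW2 : ∀ x ∈ W, (T ∘ₗ T) x ∈ W := fun x hx => hW _ (hW _ hx)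
    let A : W →ₗ[ℝ] W := (T ∘ₗ T).restrict hW2
    have hA : ∀ x : W, (A x : V) = T (T x) := fun x => rfl
    have hAs : A.IsSymmetric := by
      intro x y
      rw [Submodule.coe_inner, Submodule.coe_inner, hA, hA, hT, hT, neg_neg]
    let b := hAs.eigenvectorBasis rfl
    have hb : ∀ i, A (b i) = hAs.eigenvalues rfl i • b i := fun i =>
      hAs.apply_eigenvectorBasis rfl i
    obtain ⟨i, hi⟩ : ∃ i, hAs.eigenvalues rfl i ≠ 0 := by
      by_contra! hz
      refine h0 fun x hx => ?_
      -- If all eigenvalues vanish then `T²` is zero on `W`, and `‖T x‖² = -⟨x, T² x⟩` makes `T`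
      -- zero there.
      have hA0 : A = 0 := b.toBasis.ext fun i => by
        rw [OrthonormalBasis.coe_toBasis, hb, hz, zero_smul, LinearMap.zero_apply]
      have h1 : T (T x) = 0 := by
        rw [← hA ⟨x, hx⟩, hA0]
        rfl
      have h2 : ⟪T x, T x⟫_ℝ = 0 := by rw [hT, h1, inner_zero_right, neg_zero]
      exact inner_self_eq_zero.mp h2
    set μ := hAs.eigenvalues rfl i
    set v : V := ((b i : W) : V) with hv
    have hvn : ‖v‖ = 1 := b.norm_eq_one i
    have hvv : ⟪v, v⟫_ℝ = 1 := by rw [real_inner_self_eq_norm_sq, hvn, one_pow]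
    have hTT : T (T v) = μ • v := by
      rw [hv, ← hA, hb]
      rfl
    have hnorm : ‖T v‖ ^ 2 = -μ := by
      rw [← real_inner_self_eq_norm_sq, hT, hTT, inner_smul_right, hvv, mul_one]
    have hpos : 0 < ‖T v‖ := by
      refine lt_of_le_of_ne (norm_nonneg _) fun h => hi ?_
      rw [← h] at hnorm
      linarith
    refine ⟨‖T v‖, v, ‖T v‖⁻¹ • T v, hpos.le, (b i).2, W.smul_mem _ (hW _ (b i).2), hvn, ?_, ?_,
      ?_, ?_⟩
    · rw [norm_smul, norm_inv, norm_norm, inv_mul_cancel₀ hpos.ne']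
    · have h := hT v v
      rw [real_inner_comm] at h
      rw [inner_smul_right, show ⟪v, T v⟫_ℝ = 0 by linarith, mul_zero]
    · rw [smul_smul, mul_inv_cancel₀ hpos.ne', one_smul]
    · rw [map_smul, hTT, smul_smul]
      congr 1
      field_simp
      linarith

/-- A skew-symmetric endomorphism rotates `m` orthogonal planes of every invariant subspace of
dimension at least `2 m`. -/
theorem exists_invariant_planes (T : V →ₗ[ℝ] V) (hT : ∀ x y, ⟪T x, y⟫_ℝ = -⟪x, T y⟫_ℝ) (m : ℕ) :
    ∀ W : Submodule ℝ V, (∀ x ∈ W, T x ∈ W) → 2 * m ≤ Module.finrank ℝ W →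
      ∃ (l : Fin m → ℝ) (v w : Fin m → V), (∀ i, 0 ≤ l i) ∧ (∀ i, v i ∈ W) ∧ (∀ i, w i ∈ W) ∧
        (∀ i j, ⟪v i, v j⟫_ℝ = if i = j then 1 else 0) ∧
        (∀ i j, ⟪w i, w j⟫_ℝ = if i = j then 1 else 0) ∧ (∀ i j, ⟪v i, w j⟫_ℝ = 0) ∧
        (∀ i, T (v i) = l i • w i) ∧ (∀ i, T (w i) = -l i • v i) := by
  induction m with
  | zero =>
    intro W _ _
    exact ⟨Fin.elim0, Fin.elim0, Fin.elim0, fun i => i.elim0, fun i => i.elim0, fun i => i.elim0,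
      fun i => i.elim0, fun i => i.elim0, fun i => i.elim0, fun i => i.elim0, fun i => i.elim0⟩
  | succ m ih =>
    intro W hW hd
    obtain ⟨l₀, v₀, w₀, hl₀, hv₀, hw₀, nv, nw, hvw, hTv, hTw⟩ :=
      exists_invariant_plane T hT W hW (by omega)
    -- The orthogonal complement of the plane in `W`, taken as a kernel of two functionals: its
    -- dimension drops by at most two, and skewness makes it invariant.
    let φ : W →ₗ[ℝ] ℝ × ℝ := ((innerₛₗ ℝ v₀).prod (innerₛₗ ℝ w₀)).comp W.subtype
    have hφ : ∀ x : W, φ x = (⟪v₀, (x : V)⟫_ℝ, ⟪w₀, (x : V)⟫_ℝ) := fun _ => rfl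
    let W' : Submodule ℝ V := (LinearMap.ker φ).map W.subtype
    have hmem : ∀ x, x ∈ W' ↔ x ∈ W ∧ ⟪v₀, x⟫_ℝ = 0 ∧ ⟪w₀, x⟫_ℝ = 0 := by
      intro x
      simp only [W', Submodule.mem_map, LinearMap.mem_ker, hφ, Prod.mk_eq_zero]
      constructor
      · rintro ⟨y, hy, rfl⟩
        exact ⟨y.2, hy⟩
      · rintro ⟨hx, h⟩
        exact ⟨⟨x, hx⟩, h, rfl⟩
    have hinv : ∀ x ∈ W', T x ∈ W' := by
      intro x hx
      obtain ⟨h1, h2, h3⟩ := (hmem x).mp hx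
      refine (hmem _).mpr ⟨hW x h1, ?_, ?_⟩
      · rw [real_inner_comm, hT, hTv, inner_smul_right, real_inner_comm, h3, mul_zero, neg_zero]
      · rw [real_inner_comm, hT, hTw, inner_smul_right, real_inner_comm, h2, mul_zero, neg_zero]
    have hdim : 2 * m ≤ Module.finrank ℝ W' := by
      have h1 := φ.finrank_range_add_finrank_ker
      have h2 : Module.finrank ℝ (LinearMap.range φ) ≤ 2 :=
        (Submodule.finrank_le _).trans (by simp)
      have h3 : Module.finrank ℝ W' = Module.finrank ℝ (LinearMap.ker φ) :=
        Submodule.finrank_map_subtype_eq W _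
      omega
    obtain ⟨l, v, w, hl, hv, hw, hvv, hww, hvw', hTv', hTw'⟩ := ih W' hinv hdim
    have hv' := fun i => (hmem _).mp (hv i)
    have hw' := fun i => (hmem _).mp (hw i)
    have hv₀v₀ : ⟪v₀, v₀⟫_ℝ = 1 := by rw [real_inner_self_eq_norm_sq, nv, one_pow]
    have hw₀w₀ : ⟪w₀, w₀⟫_ℝ = 1 := by rw [real_inner_self_eq_norm_sq, nw, one_pow]
    refine ⟨Fin.cons l₀ l, Fin.cons v₀ v, Fin.cons w₀ w, Fin.cases hl₀ hl,
      Fin.cases hv₀ fun i => (hv' i).1, Fin.cases hw₀ fun i => (hw' i).1, ?_, ?_, ?_,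
      Fin.cases hTv hTv', Fin.cases hTw hTw'⟩
    · refine Fin.cases (Fin.cases ?_ fun j => ?_) fun i => Fin.cases ?_ fun j => ?_
      · exact hv₀v₀
      · simpa [(Fin.succ_ne_zero _).symm] using (hv' j).2.1
      · simpa [real_inner_comm] using (hv' i).2.1
      · simpa using hvv i j
    · refine Fin.cases (Fin.cases ?_ fun j => ?_) fun i => Fin.cases ?_ fun j => ?_
      · exact hw₀w₀
      · simpa [(Fin.succ_ne_zero _).symm] using (hw' j).2.2
      · simpa [real_inner_comm] using (hw' i).2.2
      · simpa using hww i j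
    · refine Fin.cases (Fin.cases ?_ fun j => ?_) fun i => Fin.cases ?_ fun j => ?_
      · exact hvw
      · exact (hw' j).2.1
      · exact (real_inner_comm _ _).trans (hv' i).2.2
      · exact hvw' i j

end SkewMap

open Matrix

theorem inner_toEuclideanLin_skew {S : Matrix (Fin 7) (Fin 7) ℝ} (hS : Sᵀ = -S)
    (x y : EuclideanSpace ℝ (Fin 7)) :
    ⟪S.toEuclideanLin x, y⟫_ℝ = -⟪x, S.toEuclideanLin y⟫_ℝ := by
  simp only [EuclideanSpace.inner_eq_star_dotProduct, star_trivial, Matrix.toLpLin_apply]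
  rw [dotProduct_mulVec, ← mulVec_transpose, hS, neg_mulVec, neg_dotProduct]

/-- Reversing the kernel vector does not affect the normal form. This is the freedom that corrects
the orientation of the basis. -/
theorem skewNormalForm_mul_diagonal (a b c : ℝ) :
    skewNormalForm a b c * diagonal ![1, 1, 1, 1, 1, 1, -1] = skewNormalForm a b c ∧
      diagonal ![1, 1, 1, 1, 1, 1, -1] * skewNormalForm a b c = skewNormalForm a b c := by
  constructor <;> ext i j
  · rw [mul_diagonal]
    fin_cases j <;> fin_cases i <;> simp [skewNormalForm]
  · rw [diagonal_mul]
    fin_cases i <;> fin_cases j <;> simp [skewNormalForm]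

/-- An orthogonal normal form can be made special orthogonal. -/
theorem exists_specialOrthogonal_skewNormalForm {S P : Matrix (Fin 7) (Fin 7) ℝ} {a b c : ℝ}
    (hP : Pᵀ * P = 1) (hSP : S * P = P * skewNormalForm a b c) :
    ∃ P ∈ specialOrthogonalGroup (Fin 7) ℝ, S = P * skewNormalForm a b c * Pᵀ := by
  have hP' : P * Pᵀ = 1 := mul_eq_one_comm.mp hP
  have hS : S = P * skewNormalForm a b c * Pᵀ := by
    rw [← hSP, Matrix.mul_assoc, hP', mul_one]
  have hdet : P.det * P.det = 1 := by
    have := congrArg det hP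
    rwa [det_mul, det_transpose, det_one] at this
  rcases mul_self_eq_one_iff.mp hdet with h | h
  · exact ⟨P, mem_specialOrthogonalGroup_iff.mpr
      ⟨(mem_orthogonalGroup_iff (Fin 7) ℝ).mpr hP', h⟩, hS⟩
  · set D : Matrix (Fin 7) (Fin 7) ℝ := diagonal ![1, 1, 1, 1, 1, 1, -1] with hD
    have hDt : Dᵀ = D := diagonal_transpose _
    have hDD : D * D = 1 := by
      rw [hD, diagonal_mul_diagonal, ← diagonal_one]
      congr 1
      ext i
      fin_cases i <;> simp
    have hDdet : D.det = -1 := by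
      rw [hD, det_diagonal, Fin.prod_univ_seven]
      simp
    obtain ⟨h1, h2⟩ := skewNormalForm_mul_diagonal a b c
    refine ⟨P * D, mem_specialOrthogonalGroup_iff.mpr
      ⟨(mem_orthogonalGroup_iff (Fin 7) ℝ).mpr ?_, ?_⟩, ?_⟩
    · calc P * D * (P * D)ᵀ = P * (D * D) * Pᵀ := by
            rw [transpose_mul, hDt]; simp only [Matrix.mul_assoc]
        _ = 1 := by rw [hDD, mul_one, hP']
    · rw [det_mul, h, hDdet]; norm_num
    · calc S = P * (D * skewNormalForm a b c * D) * Pᵀ := by rw [h2, h1, hS]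
        _ = _ := by rw [transpose_mul, hDt]; simp only [Matrix.mul_assoc]

/-- The normal form of a skew-symmetric endomorphism of `ℝ⁷`. -/
theorem exists_isAssociated {S : Matrix (Fin 7) (Fin 7) ℝ} (hS : Sᵀ = -S) :
    ∃ a b c : ℝ, IsAssociated S a b c := by
  set T := S.toEuclideanLin with hTdef
  have hT : ∀ x y, ⟪T x, y⟫_ℝ = -⟪x, T y⟫_ℝ := inner_toEuclideanLin_skew hS
  obtain ⟨l', v', w', hl', -, -, hvv', hww', hvw', hTv', hTw'⟩ :=
    exists_invariant_planes T hT 3 ⊤ (fun _ _ => trivial) (by simp)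
  set σ := Tuple.sort l'
  obtain ⟨l, hl⟩ : ∃ l, l = l' ∘ σ := ⟨_, rfl⟩
  obtain ⟨v, hv⟩ : ∃ v, v = v' ∘ σ := ⟨_, rfl⟩
  obtain ⟨w, hw⟩ : ∃ w, w = w' ∘ σ := ⟨_, rfl⟩
  have hmono : Monotone l := hl ▸ Tuple.monotone_sort l'
  have hl0 : ∀ i, 0 ≤ l i := fun i => by rw [hl]; exact hl' _
  have hvv : ∀ i j, ⟪v i, v j⟫_ℝ = if i = j then 1 else 0 := fun i j => by
    rw [hv]; simpa using hvv' (σ i) (σ j)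
  have hww : ∀ i j, ⟪w i, w j⟫_ℝ = if i = j then 1 else 0 := fun i j => by
    rw [hw]; simpa using hww' (σ i) (σ j)
  have hvw : ∀ i j, ⟪v i, w j⟫_ℝ = 0 := fun i j => by rw [hv, hw]; exact hvw' _ _
  have hwv : ∀ i j, ⟪w i, v j⟫_ℝ = 0 := fun i j => (real_inner_comm _ _).trans (hvw j i)
  have hTv : ∀ i, T (v i) = l i • w i := fun i => by rw [hv, hw, hl]; exact hTv' _
  have hTw : ∀ i, T (w i) = -l i • v i := fun i => by rw [hv, hw, hl]; exact hTw' _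
  clear hvv' hww' hvw' hTv' hTw'
  -- The three planes span at most six dimensions, which leaves a unit vector orthogonal to all of
  -- them.
  obtain ⟨u, hu, huv, huw⟩ : ∃ u : EuclideanSpace ℝ (Fin 7), ‖u‖ = 1 ∧ (∀ i, ⟪v i, u⟫_ℝ = 0) ∧
      ∀ i, ⟪w i, u⟫_ℝ = 0 := by
    let K := Submodule.span ℝ (Set.range (Sum.elim v w))
    have hK : Module.finrank ℝ K ≤ 6 := (finrank_range_le_card _).trans (by simp)
    have hK' := K.finrank_add_finrank_orthogonal
    rw [finrank_euclideanSpace_fin] at hK'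
    have hpos : 0 < Module.finrank ℝ Kᗮ := by omega
    let e := stdOrthonormalBasis ℝ Kᗮ
    let i₀ : Fin (Module.finrank ℝ Kᗮ) := ⟨0, hpos⟩
    refine ⟨e i₀, e.norm_eq_one i₀, fun i => ?_, fun i => ?_⟩
    · exact Submodule.inner_right_of_mem_orthogonal (K := K)
        (Submodule.subset_span ⟨Sum.inl i, rfl⟩) (e i₀).2
    · exact Submodule.inner_right_of_mem_orthogonal (K := K)
        (Submodule.subset_span ⟨Sum.inr i, rfl⟩) (e i₀).2
  have huu : ⟪u, u⟫_ℝ = 1 := by rw [real_inner_self_eq_norm_sq, hu, one_pow]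
  have hvu : ∀ i, ⟪u, v i⟫_ℝ = 0 := fun i => (real_inner_comm _ _).trans (huv i)
  have hwu : ∀ i, ⟪u, w i⟫_ℝ = 0 := fun i => (real_inner_comm _ _).trans (huw i)
  let f : Fin 7 → EuclideanSpace ℝ (Fin 7) := ![v 0, w 0, v 1, w 1, v 2, w 2, u]
  have hf : Orthonormal ℝ f := by
    rw [orthonormal_iff_ite]
    intro i j
    fin_cases i <;> fin_cases j <;>
      simp only [f, Fin.zero_eta, Fin.mk_one, Fin.reduceFinMk, Matrix.cons_val, hvv, hww, hvw, hwv,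
        huv, huw, hvu, hwu, huu] <;> simp
  let B : OrthonormalBasis (Fin 7) ℝ (EuclideanSpace ℝ (Fin 7)) := OrthonormalBasis.mk hf (by
    rw [hf.linearIndependent.span_eq_top_of_card_eq_finrank' (by simp)])
  have hB : ⇑B = f := OrthonormalBasis.coe_mk _ _
  -- By skewness `T u` is orthogonal to the three planes, because they are invariant, and to `u`
  -- itself.
  have hTu : T u = 0 := by
    rw [← B.sum_repr' (T u)]
    refine Finset.sum_eq_zero fun i _ => ?_
    have : ⟪f i, T u⟫_ℝ = 0 := by
      rw [← neg_eq_zero, ← hT]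
      have h6 : ⟪T u, u⟫_ℝ = 0 := by
        have := hT u u
        rw [real_inner_comm (T u) u] at this
        linarith
      fin_cases i <;>
        simp only [f, Fin.zero_eta, Fin.mk_one, Fin.reduceFinMk, Matrix.cons_val, hTv, hTw,
          real_inner_smul_left, huv, huw, mul_zero, h6]
    rw [hB, this, zero_smul]
  have hPO : (Matrix.of fun i j => f j i)ᵀ * (Matrix.of fun i j => f j i) = 1 := by
    ext i j
    rw [Matrix.one_apply, ← orthonormal_iff_ite.mp hf i j, Matrix.mul_apply,
      PiLp.inner_apply]
    exact Finset.sum_congr rfl fun k _ => mul_comm _ _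
  refine ⟨l 0, l 1, l 2, ⟨hl0 0, hmono (by decide), hmono (by decide)⟩,
    exists_specialOrthogonal_skewNormalForm hPO ?_⟩
  ext i j
  have hcol : (S * Matrix.of fun i j => f j i) i j = T (f j) i := by
    rw [hTdef, Matrix.toLpLin_apply, Matrix.mul_apply]
    rfl
  rw [hcol, Matrix.mul_apply, Fin.sum_univ_seven]
  fin_cases j <;>
    simp [f, skewNormalForm, hTv, hTw, hTu, mul_comm]

/-! ### Trace invariants and the Lie algebra of `G₂` -/

theorem trace_skewNormalForm (a b c : ℝ) :
    (skewNormalForm a b c * skewNormalForm a b c).trace = -2 * (a ^ 2 + b ^ 2 + c ^ 2) ∧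
      (skewNormalForm a b c * skewNormalForm a b c *
        (skewNormalForm a b c * skewNormalForm a b c)).trace = 2 * (a ^ 4 + b ^ 4 + c ^ 4) := by
  have h : skewNormalForm a b c * skewNormalForm a b c =
      diagonal ![-a ^ 2, -a ^ 2, -b ^ 2, -b ^ 2, -c ^ 2, -c ^ 2, 0] := by
    ext i j
    rw [Matrix.mul_apply, Fin.sum_univ_seven]
    fin_cases i <;> fin_cases j <;> simp [skewNormalForm, pow_two]
  rw [h, diagonal_mul_diagonal, trace_diagonal, trace_diagonal, Fin.sum_univ_seven,
    Fin.sum_univ_seven]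
  simp only [Matrix.cons_val]
  constructor <;> ring

/-- A general element of the Lie algebra of `G₂`. -/
def g2Matrix (a b c d e f g h k l m n p q : ℝ) : Matrix (Fin 7) (Fin 7) ℝ :=
  !![0, m + n, p - l, g - d, -c - h, b - e, a + f;
     -m - n, 0, k + q, a, b, c, d;
     -p + l, -k - q, 0, e, f, g, h;
     -g + d, -a, -e, 0, k, l, m;
     c + h, -b, -f, -k, 0, n, p;
     -b + e, -c, -g, -l, -n, 0, q;
     -a - f, -d, -h, -m, -p, -q, 0]

-- The invariant polynomials of `G₂` are generated in degrees 2 and 6, so `tr X⁴` must be a multiple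
-- of `(tr X²)²`. Weights `(a, b, a + b)` fix the constant: with `q = a² + ab + b²`, the traces are
-- `tr X² = -4q` and `tr X⁴ = 4q²`. The proof expands the identity in the fourteen parameters.
set_option maxHeartbeats 4000000 in
theorem four_mul_trace_g2Matrix (a b c d e f g h k l m n p q : ℝ) :
    4 * (g2Matrix a b c d e f g h k l m n p q * g2Matrix a b c d e f g h k l m n p q *
      (g2Matrix a b c d e f g h k l m n p q * g2Matrix a b c d e f g h k l m n p q)).trace =
      (g2Matrix a b c d e f g h k l m n p q * g2Matrix a b c d e f g h k l m n p q).trace ^ 2 := by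
  simp only [Matrix.trace, Matrix.diag_apply, Matrix.mul_apply, Fin.sum_univ_seven]
  simp only [g2Matrix, Matrix.of_apply, Matrix.cons_val]
  ring

/-- The seven equations `g2Part X = 0` determine the first row and the entry `X 1 2` from the
fourteen remaining entries above the diagonal. -/
theorem eq_g2Matrix {X : Matrix (Fin 7) (Fin 7) ℝ} (hX : Xᵀ = -X)
    (hg : QuasiAbelian.g2Part X = 0) :
    X = g2Matrix (X 1 3) (X 1 4) (X 1 5) (X 1 6) (X 2 3) (X 2 4) (X 2 5) (X 2 6) (X 3 4) (X 3 5) (X 3 6) (X 4 5) (X 4 6) (X 5 6) := by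
  have hs : ∀ i j, X j i = -X i j := fun i j => congrFun (congrFun hX i) j
  have hd : ∀ i, X i i = 0 := fun i => by linarith [hs i i]
  have g : ∀ i, QuasiAbelian.g2Part X i = 0 := fun i => congrFun hg i
  have g0 := g 0
  have g1 := g 1
  have g2 := g 2
  have g3 := g 3
  have g4 := g 4
  have g5 := g 5
  have g6 := g 6
  simp only [QuasiAbelian.g2Part, Matrix.cons_val] at g0 g1 g2 g3 g4 g5 g6
  have e01 : X 0 1 = X 3 6 + X 4 5 := by
    linarith [hs 0 1, hs 3 6, hs 4 5]
  have e02 : X 0 2 = X 4 6 - X 3 5 := by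
    linarith [hs 0 2, hs 3 5, hs 4 6]
  have e03 : X 0 3 = X 2 5 - X 1 6 := by
    linarith [hs 0 3, hs 1 6, hs 2 5]
  have e04 : X 0 4 = -X 1 5 - X 2 6 := by
    linarith [hs 0 4, hs 1 5, hs 2 6]
  have e05 : X 0 5 = X 1 4 - X 2 3 := by
    linarith [hs 0 5, hs 1 4, hs 2 3]
  have e06 : X 0 6 = X 1 3 + X 2 4 := by
    linarith [hs 0 6, hs 1 3, hs 2 4]
  have e12 : X 1 2 = X 3 4 + X 5 6 := by
    linarith [hs 1 2, hs 3 4, hs 5 6]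
  have key : ∀ i j, i ≤ j → X i j = g2Matrix (X 1 3) (X 1 4) (X 1 5) (X 1 6) (X 2 3) (X 2 4) (X 2 5) (X 2 6) (X 3 4) (X 3 5) (X 3 6) (X 4 5) (X 4 6) (X 5 6) i j := by
    intro i j hij
    fin_cases i <;> fin_cases j <;>
      first
      | exact absurd hij (by decide)
      | exact hd _
      | rfl
      | assumption
  have hskew : ∀ i j, g2Matrix (X 1 3) (X 1 4) (X 1 5) (X 1 6) (X 2 3) (X 2 4) (X 2 5) (X 2 6) (X 3 4) (X 3 5) (X 3 6) (X 4 5) (X 4 6) (X 5 6) j i =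
      -g2Matrix (X 1 3) (X 1 4) (X 1 5) (X 1 6) (X 2 3) (X 2 4) (X 2 5) (X 2 6) (X 3 4) (X 3 5) (X 3 6) (X 4 5) (X 4 6) (X 5 6) i j := by
    intro i j
    fin_cases i <;> fin_cases j <;> simp [g2Matrix] <;> ring
  ext i j
  rcases le_total i j with hij | hij
  · exact key i j hij
  · rw [hs j i, key j i hij, hskew j i]

/-- On the Lie algebra of `G₂` the quartic invariant is a multiple of the square of the
quadratic one. -/
theorem four_mul_trace_pow_four {X : Matrix (Fin 7) (Fin 7) ℝ} (hX : Xᵀ = -X)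
    (hg : QuasiAbelian.g2Part X = 0) :
    4 * (X * X * (X * X)).trace = (X * X).trace ^ 2 := by
  rw [eq_g2Matrix hX hg]
  exact four_mul_trace_g2Matrix _ _ _ _ _ _ _ _ _ _ _ _ _ _

theorem skewNormalForm_zero : skewNormalForm 0 0 0 = 0 := by
  ext i j
  fin_cases i <;> fin_cases j <;> simp [skewNormalForm]

/-! ### Rotating the normal form into and out of the Lie algebra of `G₂` -/

/-- The cyclic permutation that moves the kernel vector of the normal form to the front. -/
def kernelFirst : Equiv.Perm (Fin 7) where
  toFun := ![6, 0, 1, 2, 3, 4, 5]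
  invFun := ![1, 2, 3, 4, 5, 6, 0]
  left_inv := by decide
  right_inv := by decide

/-- The permutation that moves the kernel vector and the third plane of the normal form to the
front. -/
def thirdPlaneFirst : Equiv.Perm (Fin 7) where
  toFun := ![6, 4, 5, 0, 1, 2, 3]
  invFun := ![3, 4, 5, 6, 1, 2, 0]
  left_inv := by decide
  right_inv := by decide

theorem submatrix_mem_specialOrthogonalGroup {P : Matrix (Fin 7) (Fin 7) ℝ}
    (hP : P ∈ specialOrthogonalGroup (Fin 7) ℝ) {σ : Equiv.Perm (Fin 7)}
    (hσ : Equiv.Perm.sign σ = 1) : P.submatrix id σ ∈ specialOrthogonalGroup (Fin 7) ℝ := by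
  obtain ⟨hO, hdet⟩ := mem_specialOrthogonalGroup_iff.mp hP
  refine mem_specialOrthogonalGroup_iff.mpr ⟨(mem_orthogonalGroup_iff' (Fin 7) ℝ).mpr ?_, ?_⟩
  · have h : Pᵀ * P = 1 := (mem_orthogonalGroup_iff' (Fin 7) ℝ).mp hO
    calc (P.submatrix id σ)ᵀ * P.submatrix id σ = (Pᵀ * P).submatrix σ σ := by
          rw [transpose_submatrix, submatrix_mul _ _ _ id _ Function.bijective_id]
      _ = 1 := by rw [h, submatrix_one_equiv]
  · rw [det_permute', hσ, hdet]
    simp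

theorem conj_submatrix {P N : Matrix (Fin 7) (Fin 7) ℝ}
    (hP : P ∈ specialOrthogonalGroup (Fin 7) ℝ) (σ : Equiv.Perm (Fin 7)) :
    (P.submatrix id σ)ᵀ * (P * N * Pᵀ) * P.submatrix id σ = N.submatrix σ σ := by
  have h : Pᵀ * P = 1 :=
    (mem_orthogonalGroup_iff' (Fin 7) ℝ).mp (mem_specialOrthogonalGroup_iff.mp hP).1
  calc (P.submatrix id σ)ᵀ * (P * N * Pᵀ) * P.submatrix id σ
      = (Pᵀ * (P * N * Pᵀ) * P).submatrix σ σ := by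
        rw [transpose_submatrix, submatrix_mul _ _ _ id _ Function.bijective_id,
          submatrix_mul _ _ _ id _ Function.bijective_id, submatrix_id_id]
    _ = ((Pᵀ * P) * N * (Pᵀ * P)).submatrix σ σ := by simp only [Matrix.mul_assoc]
    _ = N.submatrix σ σ := by rw [h, one_mul, mul_one]

/-- With the kernel vector in front, the planes occupy the index pairs `(1, 2)`, `(3, 4)`, `(5, 6)`.
The first pair enters `g2Part` with the sign opposite to the other two, so the choice of leading
plane decides which signed sum of weights appears. -/
theorem g2Part_kernelFirst (a b c : ℝ) :
    QuasiAbelian.g2Part ((skewNormalForm a b c).submatrix kernelFirst kernelFirst) =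
      Pi.single 0 (2 * (b + c - a)) := by
  ext i
  fin_cases i <;> simp [QuasiAbelian.g2Part, skewNormalForm, kernelFirst]
  ring

theorem g2Part_thirdPlaneFirst (a b c : ℝ) :
    QuasiAbelian.g2Part ((skewNormalForm a b c).submatrix thirdPlaneFirst thirdPlaneFirst) =
      Pi.single 0 (2 * (a + b - c)) := by
  ext i
  fin_cases i <;> simp [QuasiAbelian.g2Part, skewNormalForm, thirdPlaneFirst]
  ring

theorem IsAssociated.exists_g2Part {S : Matrix (Fin 7) (Fin 7) ℝ} {a b c : ℝ}
    (h : IsAssociated S a b c) :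
    (∃ R ∈ specialOrthogonalGroup (Fin 7) ℝ,
      QuasiAbelian.g2Part (Rᵀ * S * R) = Pi.single 0 (2 * (a + b - c))) ∧
    ∃ R ∈ specialOrthogonalGroup (Fin 7) ℝ,
      QuasiAbelian.g2Part (Rᵀ * S * R) = Pi.single 0 (2 * (b + c - a)) := by
  obtain ⟨-, P, hP, rfl⟩ := h
  exact ⟨⟨_, submatrix_mem_specialOrthogonalGroup hP (σ := thirdPlaneFirst) (by decide), by
      rw [conj_submatrix hP, g2Part_thirdPlaneFirst]⟩,
    ⟨_, submatrix_mem_specialOrthogonalGroup hP (σ := kernelFirst) (by decide), by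
      rw [conj_submatrix hP, g2Part_kernelFirst]⟩⟩

theorem trace_conj_mul_conj {R S : Matrix (Fin 7) (Fin 7) ℝ} (hR : R * Rᵀ = 1) :
    (Rᵀ * S * R * (Rᵀ * S * R)).trace = (S * S).trace ∧
      (Rᵀ * S * R * (Rᵀ * S * R) * (Rᵀ * S * R * (Rᵀ * S * R))).trace =
        (S * S * (S * S)).trace := by
  have h : ∀ A B : Matrix (Fin 7) (Fin 7) ℝ, Rᵀ * A * R * (Rᵀ * B * R) = Rᵀ * (A * B) * R := by
    intro A B
    calc Rᵀ * A * R * (Rᵀ * B * R) = Rᵀ * A * (R * Rᵀ) * B * R := by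
          simp only [Matrix.mul_assoc]
      _ = _ := by rw [hR, mul_one]; simp only [Matrix.mul_assoc]
  have ht : ∀ A : Matrix (Fin 7) (Fin 7) ℝ, (Rᵀ * A * R).trace = A.trace := by
    intro A
    rw [trace_mul_comm, ← Matrix.mul_assoc, hR, one_mul]
  rw [h, h, ht, ht]
  exact ⟨rfl, rfl⟩

/-- The weights of an element of the Lie algebra of `G₂` satisfy `c = a + b`. -/
theorem eq_add_of_four_mul_sum {a b c : ℝ} (ha : 0 ≤ a) (hab : a ≤ b) (hbc : b ≤ c)
    (h : 2 * (a ^ 4 + b ^ 4 + c ^ 4) = (a ^ 2 + b ^ 2 + c ^ 2) ^ 2) : c = a + b := by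
  -- Heron's factorization of `(a² + b² + c²)² - 2(a⁴ + b⁴ + c⁴)`. Under `0 ≤ a ≤ b ≤ c`, the
  -- vanishing of any one factor forces `c = a + b`.
  have h' : (a + b + c) * ((a + b - c) * ((a - b + c) * (b + c - a))) = 0 := by
    linear_combination -h
  rcases mul_eq_zero.mp h' with h1 | h1
  · linarith
  rcases mul_eq_zero.mp h1 with h2 | h2
  · linarith
  rcases mul_eq_zero.mp h2 with h3 | h3 <;> linarith

/-- A conjugate of `S` in the Lie algebra of `G₂` and its normal form share the traces of square and
fourth power, so the quartic relation passes to the weights. The converse is the permutation placing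
the third plane first. -/
theorem exists_g2Part_eq_zero_iff {S : Matrix (Fin 7) (Fin 7) ℝ} (hS : Sᵀ = -S) :
    (∃ R ∈ specialOrthogonalGroup (Fin 7) ℝ, QuasiAbelian.g2Part (Rᵀ * S * R) = 0) ↔
      ∃ l₁ l₂ : ℝ, IsAssociated S l₁ l₂ (l₁ + l₂) := by
  constructor
  · rintro ⟨R, hR, hg⟩
    obtain ⟨a, b, c, h⟩ := exists_isAssociated hS
    have hc : c = a + b := by
      obtain ⟨⟨ha, hab, hbc⟩, P, hP, hSP⟩ := h
      have hR' : R * Rᵀ = 1 :=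
        (mem_orthogonalGroup_iff (Fin 7) ℝ).mp (mem_specialOrthogonalGroup_iff.mp hR).1
      have hP' : Pᵀ * Pᵀᵀ = 1 :=
        (mem_orthogonalGroup_iff' (Fin 7) ℝ).mp (mem_specialOrthogonalGroup_iff.mp hP).1
      have hskew : (Rᵀ * S * R)ᵀ = -(Rᵀ * S * R) := by
        rw [transpose_mul, transpose_mul, transpose_transpose, hS, Matrix.neg_mul,
          Matrix.mul_neg, Matrix.mul_assoc]
      have key := four_mul_trace_pow_four hskew hg
      obtain ⟨t1, t2⟩ := trace_conj_mul_conj (S := S) hR'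
      obtain ⟨t3, t4⟩ := trace_conj_mul_conj (S := skewNormalForm a b c) hP'
      obtain ⟨t5, t6⟩ := trace_skewNormalForm a b c
      rw [transpose_transpose, ← hSP] at t3 t4
      rw [t1, t2, t3, t4, t5, t6] at key
      exact eq_add_of_four_mul_sum ha hab hbc (by linarith)
    exact ⟨a, b, hc ▸ h⟩
  · rintro ⟨a, b, h⟩
    obtain ⟨R, hR, hg⟩ := h.exists_g2Part.1
    exact ⟨R, hR, by rw [hg, sub_self, mul_zero, Pi.single_zero]⟩

/-- A nonzero skew-symmetric endomorphism of `ℝ⁷` leaves the Lie algebra of `G₂` after a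
rotation. -/
theorem exists_g2Part_ne_zero {S : Matrix (Fin 7) (Fin 7) ℝ} (hS : Sᵀ = -S) (h0 : S ≠ 0) :
    ∃ R ∈ specialOrthogonalGroup (Fin 7) ℝ, QuasiAbelian.g2Part (Rᵀ * S * R) ≠ 0 := by
  obtain ⟨a, b, c, h⟩ := exists_isAssociated hS
  by_contra! hz
  obtain ⟨⟨R, hR, h1⟩, R', hR', h2⟩ := h.exists_g2Part
  have e1 := congrFun (h1.symm.trans (hz R hR)) 0
  have e2 := congrFun (h2.symm.trans (hz R' hR')) 0
  simp only [Pi.single_eq_same, Pi.zero_apply] at e1 e2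
  obtain ⟨⟨ha, hab, hbc⟩, P, -, hP⟩ := h
  -- Adding `a + b - c = 0` and `b + c - a = 0` gives `b = 0`. Then `0 ≤ a ≤ b` gives `a = 0`, and
  -- `c = a + b` vanishes too.
  have hb : b = 0 := by linarith
  have ha' : a = 0 := by linarith
  have hc : c = 0 := by linarith
  refine h0 ?_
  rw [hP, ha', hb, hc, skewNormalForm_zero, mul_zero, zero_mul]

/-! ### The four existence statements -/

namespace QuasiAbelian

theorem skewPart_transpose (E : Matrix (Fin 7) (Fin 7) ℝ) : (skewPart E)ᵀ = -skewPart E := by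
  rw [skewPart, transpose_smul, transpose_sub, transpose_transpose, ← smul_neg, neg_sub]

theorem symPart_add_skewPart (E : Matrix (Fin 7) (Fin 7) ℝ) : symPart E + skewPart E = E := by
  ext i j
  simp only [symPart, skewPart, Matrix.add_apply, Matrix.smul_apply, Matrix.sub_apply,
    transpose_apply, smul_eq_mul]
  ring

end QuasiAbelian

open QuasiAbelian in
theorem exists_parallel_iff {E : Matrix (Fin 7) (Fin 7) ℝ} (hE : E ≠ 0) :
    (∃ Ω : QuasiAbelian E [⋀^Fin 4]→ₗ[ℝ] ℝ, IsSpin7 Ω ∧ IsParallel Ω) ↔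
      symPart E = 0 ∧ ∃ l₁ l₂ : ℝ, 0 < l₂ ∧ IsAssociated (skewPart E) l₁ l₂ (l₁ + l₂) := by
  rw [exists_isSpin7_iff _ (fun M => symPart M = 0 ∧ g2Part M = 0) fun b hb =>
    isParallel_cayleyForm_iff hb]
  have hs : ∀ R ∈ specialOrthogonalGroup (Fin 7) ℝ,
      symPart (Rᵀ * E * R) = 0 ↔ symPart E = 0 := fun R hR => by
    simpa using symPart_conj_eq_smul_iff (E := E) hR 0
  constructor
  · rintro ⟨R, hR, h1, h2⟩
    have h1' := (hs R hR).mp h1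
    obtain ⟨l₁, l₂, hl⟩ := (exists_g2Part_eq_zero_iff (skewPart_transpose E)).mp
      ⟨R, hR, by rw [← g2Part_conj, h2]⟩
    -- If `l₂ ≤ 0` then all weights vanish, so the skew part is zero as well as the symmetric part,
    -- contradicting `E ≠ 0`.
    refine ⟨h1', l₁, l₂, lt_of_not_ge fun hle => hE ?_, hl⟩
    obtain ⟨⟨h3, h4, -⟩, P, -, hP⟩ := hl
    have e2 : l₂ = 0 := le_antisymm hle (h3.trans h4)
    have e1 : l₁ = 0 := le_antisymm (h4.trans hle) h3
    rw [← symPart_add_skewPart E, h1', hP, e1, e2, add_zero, skewNormalForm_zero,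
      mul_zero, zero_mul, zero_add]
  · rintro ⟨h1, l₁, l₂, -, hl⟩
    obtain ⟨R, hR, hg⟩ := (exists_g2Part_eq_zero_iff (skewPart_transpose E)).mpr ⟨l₁, l₂, hl⟩
    exact ⟨R, hR, (hs R hR).mpr h1, by rw [g2Part_conj, hg]⟩

open QuasiAbelian in
theorem exists_locConfParallel_iff (E : Matrix (Fin 7) (Fin 7) ℝ) :
    (∃ Ω : QuasiAbelian E [⋀^Fin 4]→ₗ[ℝ] ℝ,
        IsSpin7 Ω ∧ IsLocConfParallel Ω ∧ ¬ IsParallel Ω) ↔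
      (∃ h : ℝ, h ≠ 0 ∧ symPart E = h • (1 : Matrix (Fin 7) (Fin 7) ℝ)) ∧
        ∃ l₁ l₂ : ℝ, IsAssociated (skewPart E) l₁ l₂ (l₁ + l₂) := by
  rw [exists_isSpin7_iff _ (fun M => (∃ h : ℝ, h ≠ 0 ∧
      symPart M = h • (1 : Matrix (Fin 7) (Fin 7) ℝ)) ∧ g2Part M = 0),
    ← exists_g2Part_eq_zero_iff (skewPart_transpose E)]
  · constructor
    · rintro ⟨R, hR, ⟨h, h0, h1⟩, h2⟩
      exact ⟨⟨h, h0, (symPart_conj_eq_smul_iff hR h).mp h1⟩, R, hR, by rw [← g2Part_conj, h2]⟩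
    · rintro ⟨⟨h, h0, h1⟩, R, hR, h2⟩
      exact ⟨R, hR, ⟨h, h0, (symPart_conj_eq_smul_iff hR h).mpr h1⟩, by rw [g2Part_conj, h2]⟩
  · intro b hb
    rw [isLocConfParallel_cayleyForm_iff hb, isParallel_cayleyForm_iff hb]
    constructor
    · rintro ⟨⟨⟨h, h1⟩, h2⟩, h3⟩
      refine ⟨⟨h, ?_, h1⟩, h2⟩
      rintro rfl
      exact h3 ⟨by rw [h1, zero_smul], h2⟩
    · rintro ⟨⟨h, h0, h1⟩, h2⟩
      refine ⟨⟨⟨h, h1⟩, h2⟩, fun h3 => h0 ?_⟩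
      have := congrFun (congrFun (h1.symm.trans h3.1) 0) 0
      simpa using this

open QuasiAbelian in
theorem exists_balanced_iff (E : Matrix (Fin 7) (Fin 7) ℝ) :
    (∃ Ω : QuasiAbelian E [⋀^Fin 4]→ₗ[ℝ] ℝ, IsSpin7 Ω ∧ IsBalanced Ω) ↔
      IsUnimodular E ∧ ∃ l₁ l₂ : ℝ, IsAssociated (skewPart E) l₁ l₂ (l₁ + l₂) := by
  rw [exists_isSpin7_iff _ (fun M => M.trace = 0 ∧ g2Part M = 0) fun b hb =>
    isBalanced_cayleyForm_iff hb, ← exists_g2Part_eq_zero_iff (skewPart_transpose E),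
    isUnimodular_iff]
  constructor
  · rintro ⟨R, hR, h1, h2⟩
    exact ⟨by rw [← trace_conj hR, h1], R, hR, by rw [← g2Part_conj, h2]⟩
  · rintro ⟨h1, R, hR, h2⟩
    exact ⟨R, hR, by rw [trace_conj hR, h1], by rw [g2Part_conj, h2]⟩

-- Both pure types require `g2Part` to vanish, so a rotation with nonzero `g2Part` excludes them
-- simultaneously.
open QuasiAbelian in
theorem exists_mixed {E : Matrix (Fin 7) (Fin 7) ℝ} (hE : skewPart E ≠ 0) :
    ∃ Ω : QuasiAbelian E [⋀^Fin 4]→ₗ[ℝ] ℝ, IsSpin7 Ω ∧ IsMixed Ω := by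
  obtain ⟨R, hR, h⟩ := exists_g2Part_ne_zero (skewPart_transpose E) hE
  rw [exists_isSpin7_iff _ (fun M =>
    ¬ ((∃ h : ℝ, symPart M = h • (1 : Matrix (Fin 7) (Fin 7) ℝ)) ∧ g2Part M = 0) ∧
      ¬ (M.trace = 0 ∧ g2Part M = 0)) fun b hb => by
    rw [IsMixed, isLocConfParallel_cayleyForm_iff hb, isBalanced_cayleyForm_iff hb]]
  refine ⟨R, hR, fun h' => h ?_, fun h' => h ?_⟩ <;> rw [← g2Part_conj, h'.2]

theorem theorem7p6 (E : Matrix (Fin 7) (Fin 7) ℝ) (hE : E ≠ 0) :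
    -- parallel
    ((∃ Ω : QuasiAbelian E [⋀^Fin 4]→ₗ[ℝ] ℝ,
        QuasiAbelian.IsSpin7 Ω ∧ QuasiAbelian.IsParallel Ω) ↔
      QuasiAbelian.symPart E = 0 ∧
        ∃ l₁ l₂ : ℝ, 0 < l₂ ∧ IsAssociated (QuasiAbelian.skewPart E) l₁ l₂ (l₁ + l₂)) ∧
    -- locally conformally parallel and non-parallel
    ((∃ Ω : QuasiAbelian E [⋀^Fin 4]→ₗ[ℝ] ℝ, QuasiAbelian.IsSpin7 Ω ∧
        QuasiAbelian.IsLocConfParallel Ω ∧ ¬ QuasiAbelian.IsParallel Ω) ↔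
      (∃ h : ℝ, h ≠ 0 ∧ QuasiAbelian.symPart E = h • (1 : Matrix (Fin 7) (Fin 7) ℝ)) ∧
        ∃ l₁ l₂ : ℝ, IsAssociated (QuasiAbelian.skewPart E) l₁ l₂ (l₁ + l₂)) ∧
    -- balanced
    ((∃ Ω : QuasiAbelian E [⋀^Fin 4]→ₗ[ℝ] ℝ,
        QuasiAbelian.IsSpin7 Ω ∧ QuasiAbelian.IsBalanced Ω) ↔
      QuasiAbelian.IsUnimodular E ∧
        ∃ l₁ l₂ : ℝ, IsAssociated (QuasiAbelian.skewPart E) l₁ l₂ (l₁ + l₂)) ∧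
    -- unimodularity means that `E` is traceless
    (QuasiAbelian.IsUnimodular E ↔ E.trace = 0) ∧
    -- mixed type
    (QuasiAbelian.skewPart E ≠ 0 → ∃ Ω : QuasiAbelian E [⋀^Fin 4]→ₗ[ℝ] ℝ,
      QuasiAbelian.IsSpin7 Ω ∧ QuasiAbelian.IsMixed Ω) := by
  exact ⟨exists_parallel_iff hE, exists_locConfParallel_iff E, exists_balanced_iff E,
    QuasiAbelian.isUnimodular_iff, exists_mixed⟩
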